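/- **Setting.** One indivisible object, worth zero to the seller, may be sold to one of two bidders. Bidder $i$'s value $v_i$ lies in $[0,\bar v_i]$, where $\bar v_1\ge \bar v_2>0$. The seller knows only the means $m_i\in(0,\bar v_i)$; let $\Delta$ be the set of all Borel probability distributions $F$ on $[0,\bar v_1]\times[0,\bar v_2]$ with $\int v_i\,dF=m_i$, $i=1,2$. Let $\mathcal M$ be the set of direct deterministic mechanisms $M=(x_i,t_i)_{i=1,2}$ (measurable $x_i\in\{0,1\}$ with $x_1+x_2\le 1$, measurable real transfers $t_i$) that are dominant-strategy incentive compatible and ex post individually rational. A mechanism is *optimal* if it attains $$\sup_{M\in\mathcal M}\ \inf_{F\in\Delta}\int (t_1+t_2)\,dF .$$ For $\gamma>0$ and $r\in[0,\bar v_1]\times[0,\bar v_2]$, the *linear score auction with slope $\gamma$ and prices $r$* gives bidders 1 and 2 the scores $s_1=\gamma(v_1-r_1)$ and $s_2=v_2-r_2$. A bidder whose score exceeds both the other score and $0$ wins; a bidder whose score is below the other score or below $0$ loses; ties are broken arbitrarily, except that the object stays unsold only if both scores are negative. The winner pays the value at which her score would equal the larger of $0$ and the other score; a loser pays nothing. Call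 $(\gamma,r)$ optimal if a linear score auction with slope $\gamma$ and prices $r$ is optimal. **Proposition.** Optimality of $(\gamma,r)$ does not depend on how ties are broken (if one such auction is optimal, all of them are). Moreover: 1. (Low means.) If $\sqrt{1-m_1/\bar v_1}+\sqrt{1-m_2/\bar v_2}>1$, put $r_i^*=\bar v_i-\sqrt{\bar v_i(\bar v_i-m_i)}$, $i=1,2$. Then $(\gamma,r)$ is optimal if and only if $r=r^*$ and $$\gamma\in\left[\frac{r_1^*}{\bar v_1-r_1^*},\ \frac{\bar v_2-r_2^*}{r_2^*}\right].$$ So the optimal prices are unique; the optimal slope is not unique (the interval has more than one point). 2. (High means.) If $\sqrt{1-m_1/\bar v_1}+\sqrt{1-m_2/\bar v_2}\le 1$, the equation $$\frac{\bar v_1-\bar v_2}{(\gamma+1)^2}+\frac{\bar v_2-m_2}{\gamma^2}=\bar v_1-m_1$$ has a unique positive solution $\gamma^*$. Put $\tilde v_1=\dfrac{\gamma^*\bar v_1+\bar v_2}{\gamma^*+1}$; then $\tilde v_1\le\bar v_1$. The pair $(\gamma,r)$ with $r\in[0,\bar v_1]\times[0,\bar v_2]$ is optimal if and only if $$\gamma=\gamma^*,\qquad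 \frac{\bar v_2-r_2}{\tilde v_1-r_1}=\gamma^*,\qquad \frac{r_1}{\bar v_1}+\frac{r_2}{\bar v_2}\le 1 .$$ So the optimal slope is unique; the optimal prices are not unique. In every auction with optimal parameters, $\tilde v_1$ is the critical report of bidder 1 for winning regardless of bidder 2's report: with any $v_1>\tilde v_1$ she wins against every $v_2$, and for every $v_1<\tilde v_1$ there is a $v_2$ against which she loses. -/

import Mathlib

open MeasureTheory Set

noncomputable section

/-- A valuation (or report) profile of the two bidders; bidder 1 is index `0`, bidder 2 is
index `1`. -/
abbrev Profile : Type := Fin 2 → ℝ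

/-- A direct deterministic mechanism for two bidders whose values lie in the box
`[0, vbar 0] × [0, vbar 1]`, which is dominant-strategy incentive compatible and ex post
individually rational.  The allocation and transfer functions are written as measurable functions on
`ℝ²`; only their values on the box matter, and every measurable function on the box extends. -/
structure Mechanism (vbar : Profile) where
  /-- allocation functions -/
  x : Fin 2 → Profile → ℝ
  /-- transfers from the bidders to the seller -/
  t : Fin 2 → Profile → ℝ
  measurable_x : ∀ i, Measurable (x i)
  measurable_t : ∀ i, Measurable (t i)
  deterministic : ∀ i, ∀ v ∈ Icc 0 vbar, x i v = 0 ∨ x i v = 1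
  supply : ∀ v ∈ Icc 0 vbar, ∑ i, x i v ≤ 1
  /-- truthful reporting is a dominant strategy -/
  dsic : ∀ v ∈ Icc 0 vbar, ∀ i, ∀ w ∈ Icc 0 (vbar i),
    v i * x i (Function.update v i w) - t i (Function.update v i w) ≤ v i * x i v - t i v
  /-- truthful participation is never harmful ex post -/
  ir : ∀ v ∈ Icc 0 vbar, ∀ i, 0 ≤ v i * x i v - t i v

/-- The Borel probability distributions on the box `[0, vbar 0] × [0, vbar 1]` with mean vector
`m`. -/
def priors (vbar m : Profile) : Set (Measure Profile) :=
  {F | IsProbabilityMeasure F ∧ F (Icc 0 vbar)ᶜ = 0 ∧ ∀ i, ∫ v, v i ∂F = m i}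

namespace Mechanism

variable {vbar : Profile}

/-- Total transfer to the seller. -/
def totalTransfer (M : Mechanism vbar) (v : Profile) : ℝ := ∑ i, M.t i v

/-- Expected revenue `∫ ∑ i, t i v dF`, as the integral of the positive part minus that of the
negative part.  By individual rationality the positive part is bounded on the box, so the value is
well defined in `[-∞, ∞)` (and `-∞` can occur, as transfers need not be bounded below). -/
def revenue (M : Mechanism vbar) (F : Measure Profile) : EReal :=
  ((∫⁻ v, ENNReal.ofReal (M.totalTransfer v) ∂F : ENNReal) : EReal) -
    ((∫⁻ v, ENNReal.ofReal (-M.totalTransfer v) ∂F : ENNReal) : EReal)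

/-- Revenue guarantee: the worst-case expected revenue over all distributions with mean `m`. -/
def guarantee (M : Mechanism vbar) (m : Profile) : EReal :=
  ⨅ F ∈ priors vbar m, M.revenue F

/-- `M` attains the supremum over all mechanisms of the revenue guarantee. -/
def IsOptimal (M : Mechanism vbar) (m : Profile) : Prop :=
  ∀ M' : Mechanism vbar, M'.guarantee m ≤ M.guarantee m

/-- `M` is a linear score auction with scores `s i (v i) = β i * v i - α i`: a bidder whose score is
positive and strictly above the other score wins, a bidder whose score is negative or strictly
below the other score loses; ties are broken arbitrarily, but the object stays unsold only if both
scores are negative.  The winner pays the value at which her score would equal the larger of zero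
and the other score, the loser pays nothing. -/
structure IsLinearScoreAuction (M : Mechanism vbar) (α β : Profile) : Prop where
  α_nonneg : ∀ i, 0 ≤ α i
  β_pos : ∀ i, 0 < β i
  wins : ∀ v ∈ Icc 0 vbar, ∀ i j, j ≠ i →
    max (β j * v j - α j) 0 < β i * v i - α i → M.x i v = 1
  loses : ∀ v ∈ Icc 0 vbar, ∀ i j, j ≠ i →
    β i * v i - α i < max (β j * v j - α j) 0 → M.x i v = 0
  sold : ∀ v ∈ Icc 0 vbar, (∃ i, 0 ≤ β i * v i - α i) → ∑ i, M.x i v = 1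
  pays : ∀ v ∈ Icc 0 vbar, ∀ i j, j ≠ i →
    M.t i v = M.x i v * ((α i + max (β j * v j - α j) 0) / β i)

/-- `M` is the linear score auction (unique up to the breaking of ties) with slope `γ` and prices
`r`: the scores are `γ * (v 0 - r 0)` and `v 1 - r 1`. -/
def IsLSA (M : Mechanism vbar) (γ : ℝ) (r : Profile) : Prop :=
  M.IsLinearScoreAuction ![γ * r 0, r 1] ![γ, 1]

end Mechanism

/-- The slope `γ > 0` and the prices `r ∈ [0, vbar 0] × [0, vbar 1]` are optimal: a linear score
auction with these parameters is optimal among all mechanisms. -/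
def IsOptimalParameters (vbar m : Profile) (γ : ℝ) (r : Profile) : Prop :=
  0 < γ ∧ r ∈ Icc 0 vbar ∧ ∃ M : Mechanism vbar, M.IsLSA γ r ∧ M.IsOptimal m

/-- The equation that determines the optimal slope when means are high. -/
def SlopeEquation (vbar m : Profile) (γ : ℝ) : Prop :=
  (vbar 0 - vbar 1) / (γ + 1) ^ 2 + (vbar 1 - m 1) / γ ^ 2 = vbar 0 - m 0

/-- The value `(γ * vbar 0 + vbar 1) / (γ + 1)` of bidder 1. -/
def criticalValue (vbar : Profile) (γ : ℝ) : ℝ := (γ * vbar 0 + vbar 1) / (γ + 1)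

/-- The price `vbar i - √(vbar i * (vbar i - m i))`. -/
def lowMeansPrice (vbar m : Profile) (i : Fin 2) : ℝ :=
  vbar i - √(vbar i * (vbar i - m i))

end

/-!
The proof is linear programming duality. The guarantee of a mechanism at the mean vector `m` is the
largest value at `m` of an affine function lying below its ex post revenue on the box: integrating
such a minorant against a prior gives one inequality (`Mechanism.IsMinorant.le_guarantee`), and
separating `(m, guarantee)` from the convex set of pairs (mean, revenue bound) gives the other
(`Mechanism.exists_isMinorant`).

Write a minorant as `c - p * (vbar 0 - v 0) - q * (vbar 1 - v 1)`. Incentive compatibility and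
individual rationality restrict `(c, p, q)`: if the minorant is positive at `v`, some bidder `i`
wins there, and revenue is still at most `v i` after her value rises. Two test points turn this into
the bounds `c ≤ pivot (vbar 0) p + pivot (vbar 1) q` and `c ≤ criticalValue vbar p`
when the slopes are nonnegative; negative slopes are dominated
(`Mechanism.IsMinorant.admissible_or`).

Maximizing the value at `m` under these two bounds alone is elementary and has a unique solution.
For low means the first bound binds and the problem separates into one problem for each bidder
(`admissible_best_of_low`). For high means the solution lies on the hyperbola `p * q = 1`, where the
two bounds agree, and the slope equation is the first-order condition along it
(`admissible_best_of_high`).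

Some linear score auction has the resulting affine function as a minorant, so a mechanism is optimal
exactly if it has this minorant (`Mechanism.isOptimal_iff_isMinorant`). For a linear score auction
this can be read off from the parameters, whatever the tie-breaking rule
(`Mechanism.IsLSA.isMinorant_iff_of_mul_lt_one`, `Mechanism.IsLSA.isMinorant_iff_of_hyperbola`).
-/

noncomputable section

/-! ### Affine functions on the box -/

section

variable {vbar : Profile}

/-- The affine function with slopes `p` and `q` whose value at the top corner `vbar` of the box is
`c`. -/
def cornerAffine (vbar : Profile) (c p q : ℝ) (v : Profile) : ℝ :=
  c - (p * (vbar 0 - v 0) + q * (vbar 1 - v 1))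

lemma vec_mem_Icc {y z : ℝ} (hy : y ∈ Icc 0 (vbar 0)) (hz : z ∈ Icc 0 (vbar 1)) :
    ![y, z] ∈ Icc 0 vbar :=
  ⟨fun i => by fin_cases i <;> simp [hy.1, hz.1], fun i => by fin_cases i <;> simp [hy.2, hz.2]⟩

/-- The point `ρ ∈ [0, V]` with `s * (V - ρ) = ρ`: an affine function of one value with slope `s`
that vanishes at `ρ` takes the value `ρ` at the top `V`, so it lies below the revenue from the
posted price `ρ`, with equality at the top. -/
def pivot (V s : ℝ) : ℝ := V * s / (1 + s)

lemma pivot_mem {V s : ℝ} (hV : 0 ≤ V) (hs : 0 ≤ s) : pivot V s ∈ Icc 0 V := by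
  constructor
  · unfold pivot; positivity
  · rw [pivot, div_le_iff₀ (by linarith)]; nlinarith

lemma slope_mul_sub_pivot {V s : ℝ} (hs : 0 ≤ s) : s * (V - pivot V s) = pivot V s := by
  have : 1 + s ≠ 0 := by linarith
  rw [pivot]; field_simp; ring

lemma cornerAffine_pivot_eq {p q : ℝ} (hp : 0 ≤ p) (hq : 0 ≤ q) (v : Profile) :
    cornerAffine vbar (pivot (vbar 0) p + pivot (vbar 1) q) p q v
      = p * (v 0 - pivot (vbar 0) p) + q * (v 1 - pivot (vbar 1) q) := by
  have e0 := slope_mul_sub_pivot (V := vbar 0) hp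
  have e1 := slope_mul_sub_pivot (V := vbar 1) hq
  simp only [cornerAffine]
  linarith

lemma mul_sub_criticalValue {g : ℝ} (hg : 0 ≤ g) :
    g * (vbar 0 - criticalValue vbar g) = criticalValue vbar g - vbar 1 := by
  have : g + 1 ≠ 0 := by linarith
  rw [criticalValue]; field_simp; ring

lemma criticalValue_le (h10 : vbar 1 ≤ vbar 0) {g : ℝ} (hg : 0 ≤ g) :
    criticalValue vbar g ≤ vbar 0 := by
  rw [criticalValue, div_le_iff₀ (by linarith)]; linarith

lemma le_criticalValue (h10 : vbar 1 ≤ vbar 0) {g : ℝ} (hg : 0 ≤ g) :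
    vbar 1 ≤ criticalValue vbar g := by
  rw [criticalValue, le_div_iff₀ (by linarith)]; nlinarith

lemma pivot_le_criticalValue {s : ℝ} (h1 : 0 ≤ vbar 1) (hs : 0 ≤ s) :
    pivot (vbar 0) s ≤ criticalValue vbar s := by
  rw [pivot, criticalValue, add_comm 1 s]
  gcongr
  linarith

/-- On the hyperbola of slopes `(x, 1 / x)` the two bounds on the corner value coincide. -/
lemma pivot_add_pivot_inv {x : ℝ} (hx : 0 < x) :
    pivot (vbar 0) x + pivot (vbar 1) (1 / x) = criticalValue vbar x := by
  rw [pivot, pivot, criticalValue]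
  field_simp
  ring

/-- The pair of pivots lies on the line with slope `g` through
`(criticalValue vbar g, vbar 1)`. -/
lemma pivot_inv_eq {g : ℝ} (hg : 0 < g) :
    vbar 1 - pivot (vbar 1) (1 / g) = g * (criticalValue vbar g - pivot (vbar 0) g) := by
  rw [criticalValue, pivot, pivot]
  field_simp
  ring

/-- On the score tie line through `(criticalValue vbar g, vbar 1)`, the inequality
`r 0 / vbar 0 + r 1 / vbar 1 ≤ 1` holds exactly if the prices do not exceed the pivots,
which satisfy it with equality. -/
lemma tie_line_le_one_iff (h0 : 0 < vbar 0) (h1 : 0 < vbar 1) {g : ℝ} (hg : 0 < g)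
    {r : Profile} (hr : vbar 1 - r 1 = g * (criticalValue vbar g - r 0)) :
    r 0 / vbar 0 + r 1 / vbar 1 ≤ 1 ↔ r 0 ≤ pivot (vbar 0) g := by
  have e1 : r 1 = vbar 1 - g * (criticalValue vbar g - r 0) := by linarith
  have e : 1 - (r 0 / vbar 0 + r 1 / vbar 1)
      = (pivot (vbar 0) g - r 0) * (1 / vbar 0 + g / vbar 1) := by
    rw [e1, criticalValue, pivot]
    field_simp
    ring
  have hpos : 0 < 1 / vbar 0 + g / vbar 1 := by positivity
  rw [← sub_nonneg, e, mul_nonneg_iff_of_pos_right hpos, sub_nonneg]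

/-- The bounds on corner value and slopes that hold for the minorants, with nonnegative slopes, of
every mechanism. -/
structure Admissible (vbar : Profile) (c p q : ℝ) : Prop where
  nonneg_left : 0 ≤ p
  nonneg_right : 0 ≤ q
  le_pivot : c ≤ pivot (vbar 0) p + pivot (vbar 1) q
  le_criticalValue : c ≤ criticalValue vbar p

end

namespace Mechanism

variable {vbar : Profile}

/-! ### Individual rationality and expected revenue -/

lemma t_le (M : Mechanism vbar) {v : Profile} (hv : v ∈ Icc 0 vbar) (i : Fin 2) :
    M.t i v ≤ v i := by
  have h := M.ir v hv i
  have h0 : 0 ≤ v i := hv.1 i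
  rcases M.deterministic i v hv with hx | hx <;> rw [hx] at h <;> linarith

lemma t_nonpos_of_loses (M : Mechanism vbar) {v : Profile} (hv : v ∈ Icc 0 vbar) {i : Fin 2}
    (hx : M.x i v = 0) : M.t i v ≤ 0 := by
  have h := M.ir v hv i
  rw [hx] at h
  linarith

lemma totalTransfer_le (M : Mechanism vbar) {v : Profile} (hv : v ∈ Icc 0 vbar) :
    M.totalTransfer v ≤ vbar 0 + vbar 1 := by
  have h0 := M.t_le hv 0
  have h1 := M.t_le hv 1
  have h2 : v 0 ≤ vbar 0 := hv.2 0
  have h3 : v 1 ≤ vbar 1 := hv.2 1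
  simp only [totalTransfer, Fin.sum_univ_two]
  linarith

lemma measurable_totalTransfer (M : Mechanism vbar) : Measurable M.totalTransfer :=
  Finset.measurable_fun_sum _ fun i _ => M.measurable_t i

lemma revenue_eq_integral (M : Mechanism vbar) {F : Measure Profile}
    (h : Integrable M.totalTransfer F) :
    M.revenue F = ((∫ v, M.totalTransfer v ∂F : ℝ) : EReal) := by
  have hp : ∫⁻ v, ENNReal.ofReal (M.totalTransfer v) ∂F ≠ ⊤ := h.lintegral_lt_top.ne
  have hn : ∫⁻ v, ENNReal.ofReal (-M.totalTransfer v) ∂F ≠ ⊤ := h.neg.lintegral_lt_top.ne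
  rw [integral_eq_lintegral_pos_part_sub_lintegral_neg_part h, EReal.coe_sub,
    EReal.coe_ennreal_toReal hp, EReal.coe_ennreal_toReal hn, revenue]

/-! ### Affine minorants and the revenue guarantee -/

/-- The affine function `cornerAffine vbar c p q` lies below the ex post revenue of `M` on the
box. -/
def IsMinorant (M : Mechanism vbar) (c p q : ℝ) : Prop :=
  ∀ v ∈ Icc 0 vbar, cornerAffine vbar c p q v ≤ M.totalTransfer v

lemma integrable_apply {F : Measure Profile} [IsProbabilityMeasure F]
    (hF : ∀ᵐ v ∂F, v ∈ Icc 0 vbar) (i : Fin 2) : Integrable (fun v : Profile => v i) F :=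
  Integrable.of_mem_Icc 0 (vbar i) (measurable_pi_apply i).aemeasurable
    (hF.mono fun _ hv => ⟨hv.1 i, hv.2 i⟩)

lemma ae_mem_of_mem_priors {m : Profile} {F : Measure Profile} (hF : F ∈ priors vbar m) :
    ∀ᵐ v ∂F, v ∈ Icc 0 vbar := hF.2.1

lemma integrable_cornerAffine {F : Measure Profile} [IsProbabilityMeasure F]
    (hF : ∀ᵐ v ∂F, v ∈ Icc 0 vbar) (c p q : ℝ) :
    Integrable (cornerAffine vbar c p q) F := by
  have h0 := integrable_apply hF 0
  have h1 := integrable_apply hF 1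
  exact (integrable_const c).sub ((((integrable_const _).sub h0).const_mul _).add
    (((integrable_const _).sub h1).const_mul _))

lemma integral_cornerAffine {m : Profile} {F : Measure Profile} (hF : F ∈ priors vbar m)
    (c p q : ℝ) : ∫ v, cornerAffine vbar c p q v ∂F = cornerAffine vbar c p q m := by
  have := hF.1
  have h0 := integrable_apply (ae_mem_of_mem_priors hF) 0
  have h1 := integrable_apply (ae_mem_of_mem_priors hF) 1
  have e : ∀ v, cornerAffine vbar c p q v
      = (c - (p * vbar 0 + q * vbar 1)) + (p * v 0 + q * v 1) := by
    intro v; simp only [cornerAffine]; ring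
  have h01 : Integrable (fun v : Profile => p * v 0 + q * v 1) F :=
    (h0.const_mul _).add (h1.const_mul _)
  simp_rw [e]
  rw [integral_add (integrable_const _) h01,
    integral_add (h0.const_mul _) (h1.const_mul _), integral_const_mul, integral_const_mul,
    hF.2.2 0, hF.2.2 1]
  simp

/-- Weak duality: the value of a minorant at the mean is guaranteed. -/
lemma IsMinorant.le_guarantee {M : Mechanism vbar} {c p q : ℝ} (h : M.IsMinorant c p q)
    (m : Profile) : ((cornerAffine vbar c p q m : ℝ) : EReal) ≤ M.guarantee m := by
  refine le_iInf₂ fun F hF => ?_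
  have := hF.1
  have hae := ae_mem_of_mem_priors hF
  have hL := integrable_cornerAffine hae c p q
  have hle : cornerAffine vbar c p q ≤ᵐ[F] M.totalTransfer := hae.mono h
  have ht : Integrable M.totalTransfer F :=
    integrable_of_le_of_le M.measurable_totalTransfer.aestronglyMeasurable hle
      (hae.mono fun v hv => M.totalTransfer_le hv) hL (integrable_const _)
  rw [M.revenue_eq_integral ht, EReal.coe_le_coe_iff, ← integral_cornerAffine hF c p q]
  exact integral_mono_ae hL ht hle

/-- The pairs `(z, s)` such that some prior with mean `z` yields revenue less than `s`. -/
def revenueEpigraph (M : Mechanism vbar) : Set (Profile × ℝ) :=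
  {z | ∃ F ∈ priors vbar z.1, Integrable M.totalTransfer F ∧ ∫ v, M.totalTransfer v ∂F < z.2}

lemma convex_revenueEpigraph (M : Mechanism vbar) : Convex ℝ M.revenueEpigraph := by
  rintro ⟨z, s⟩ ⟨F, hF, hFi, hFs⟩ ⟨z', s'⟩ ⟨F', hF', hFi', hFs'⟩ a b ha hb hab
  have := hF.1
  have := hF'.1
  have hint : ∀ f : Profile → ℝ, Integrable f F → Integrable f F' →
      Integrable f (ENNReal.ofReal a • F + ENNReal.ofReal b • F') ∧
      ∫ v, f v ∂(ENNReal.ofReal a • F + ENNReal.ofReal b • F')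
        = a * ∫ v, f v ∂F + b * ∫ v, f v ∂F' := by
    intro f hf hf'
    have h1 := hf.smul_measure (c := ENNReal.ofReal a) ENNReal.ofReal_ne_top
    have h2 := hf'.smul_measure (c := ENNReal.ofReal b) ENNReal.ofReal_ne_top
    refine ⟨h1.add_measure h2, ?_⟩
    rw [integral_add_measure h1 h2, integral_smul_measure, integral_smul_measure,
      ENNReal.toReal_ofReal ha, ENNReal.toReal_ofReal hb, smul_eq_mul, smul_eq_mul]
  refine ⟨ENNReal.ofReal a • F + ENNReal.ofReal b • F', ⟨⟨?_⟩, ?_, fun i => ?_⟩, ?_, ?_⟩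
  · simp [← ENNReal.ofReal_add ha hb, hab]
  · simp [hF.2.1, hF'.2.1]
  · rw [(hint _ (integrable_apply (ae_mem_of_mem_priors hF) i)
      (integrable_apply (ae_mem_of_mem_priors hF') i)).2, hF.2.2 i, hF'.2.2 i]
    simp
  · exact (hint _ hFi hFi').1
  · rw [(hint _ hFi hFi').2]
    change _ < a * s + b * s'
    rcases ha.eq_or_lt with rfl | ha
    · have : b = 1 := by linarith
      subst this
      linarith
    · have h1 := mul_lt_mul_of_pos_left hFs ha
      have h2 := mul_le_mul_of_nonneg_left hFs'.le hb
      linarith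

lemma mem_revenueEpigraph (M : Mechanism vbar) {v : Profile} (hv : v ∈ Icc 0 vbar) {s : ℝ}
    (hs : M.totalTransfer v < s) : (v, s) ∈ M.revenueEpigraph := by
  refine ⟨Measure.dirac v, ⟨inferInstance, ?_, fun i => ?_⟩, ?_, ?_⟩
  · rw [Measure.dirac_apply' _ measurableSet_Icc.compl]
    simp [hv]
  · simp
  · exact integrable_dirac (by simp)
  · simpa using hs

/-- Strong duality: every guaranteed revenue is the value at the mean of a minorant.  A hyperplane
separates the point `(m, g)` from the convex set of pairs (mean, strictly attainable revenue); it
is not vertical because the mean is interior. -/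
lemma exists_isMinorant (M : Mechanism vbar) {m : Profile} (hm : ∀ i, m i ∈ Ioo 0 (vbar i))
    {g : ℝ} (hg : (g : EReal) ≤ M.guarantee m) :
    ∃ c p q, M.IsMinorant c p q ∧ cornerAffine vbar c p q m = g := by
  set C := M.revenueEpigraph with hC
  have hmC : (m, g) ∉ C := by
    rintro ⟨F, hF, hFi, hlt⟩
    have h1 : M.guarantee m ≤ M.revenue F := iInf₂_le F hF
    rw [M.revenue_eq_integral hFi] at h1
    have h2 := hg.trans h1
    rw [EReal.coe_le_coe_iff] at h2
    exact absurd hlt (not_lt.mpr h2)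
  have hU : IsOpen ((univ.pi fun i => Ioo 0 (vbar i)) ×ˢ Ioi (vbar 0 + vbar 1) :
      Set (Profile × ℝ)) :=
    (isOpen_set_pi finite_univ fun i _ => isOpen_Ioo).prod isOpen_Ioi
  have hUC : ((univ.pi fun i => Ioo 0 (vbar i)) ×ˢ Ioi (vbar 0 + vbar 1) :
      Set (Profile × ℝ)) ⊆ interior C := by
    refine interior_maximal ?_ hU
    rintro ⟨v, s⟩ ⟨hv, hs⟩
    have hvb : v ∈ Icc 0 vbar := ⟨fun i => (hv i trivial).1.le, fun i => (hv i trivial).2.le⟩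
    exact M.mem_revenueEpigraph hvb ((M.totalTransfer_le hvb).trans_lt hs)
  have hmU : ∀ s, vbar 0 + vbar 1 < s → (m, s) ∈ interior C := fun s hs =>
    hUC ⟨fun i _ => hm i, hs⟩
  obtain ⟨f, hf⟩ := geometric_hahn_banach_point_open M.convex_revenueEpigraph.interior
    isOpen_interior (fun h => hmC (interior_subset h))
  have hdec : ∀ (v : Profile) (s : ℝ), f (v, s)
      = f (Pi.single 0 1, 0) * v 0 + f (Pi.single 1 1, 0) * v 1 + f (0, 1) * s := by
    intro v s
    have e : ((v, s) : Profile × ℝ) = v 0 • ((Pi.single 0 1 : Profile), (0 : ℝ))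
        + v 1 • ((Pi.single 1 1 : Profile), (0 : ℝ)) + s • ((0 : Profile), (1 : ℝ)) := by
      refine Prod.ext ?_ ?_
      · funext i
        fin_cases i <;> simp
      · simp
    rw [e, map_add, map_add, map_smul, map_smul, map_smul]
    simp only [smul_eq_mul]
    ring
  set f0 := f (Pi.single 0 1, 0)
  set f1 := f (Pi.single 1 1, 0)
  set β := f (0, 1)
  -- The hyperplane is not vertical: points high above the interior point `m` lie in the interior.
  have hβ : 0 < β := by
    have h := hf _ (hmU (max (vbar 0 + vbar 1) g + 1)
      (by linarith [le_max_left (vbar 0 + vbar 1) g]))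
    rw [hdec, hdec] at h
    have h' : 0 < β * (max (vbar 0 + vbar 1) g + 1 - g) := by linarith
    exact pos_of_mul_pos_left h' (by linarith [le_max_right (vbar 0 + vbar 1) g])
  have hcl : ∀ p ∈ C, f (m, g) ≤ f p := by
    intro p hp
    have hp' : p ∈ closure (interior C) := by
      rw [M.convex_revenueEpigraph.closure_interior_eq_closure_of_nonempty_interior
        ⟨_, hmU _ (lt_add_one _)⟩]
      exact subset_closure hp
    exact closure_minimal (fun b hb => (hf b hb).le)
      (isClosed_le continuous_const f.continuous) hp'
  refine ⟨g - (f0 / β * (vbar 0 - m 0) + f1 / β * (vbar 1 - m 1)), -(f0 / β), -(f1 / β),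
    fun v hv => ?_, by simp only [cornerAffine]; ring⟩
  refine le_of_forall_gt_imp_ge_of_dense fun s hs => ?_
  have h := hcl _ (M.mem_revenueEpigraph hv hs)
  rw [hdec, hdec] at h
  have h2 : (f0 * m 0 + f1 * m 1 + β * g - f0 * v 0 - f1 * v 1) / β ≤ s := by
    rw [div_le_iff₀ hβ]; linarith
  refine le_trans (le_of_eq ?_) h2
  simp only [cornerAffine]
  field_simp
  ring

/-! ### Constraints on the minorants of a mechanism -/

/-- Where ex post revenue is positive, some bidder `i` wins, and pays at most her value `v i`; by
incentive compatibility she still wins and pays the same after raising her report, so revenue stays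
at most `v i`. -/
lemma exists_totalTransfer_update_le (M : Mechanism vbar) {v : Profile} (hv : v ∈ Icc 0 vbar)
    (hpos : 0 < M.totalTransfer v) :
    ∃ i, ∀ w ∈ Icc (v i) (vbar i), M.totalTransfer (Function.update v i w) ≤ v i := by
  obtain ⟨i, hi⟩ : ∃ i, 0 < M.t i v := by
    by_contra! h
    exact absurd hpos (not_lt.mpr (Finset.sum_nonpos fun i _ => h i))
  have hxi : M.x i v = 1 := (M.deterministic i v hv).resolve_left fun h =>
    absurd hi (not_lt.mpr (M.t_nonpos_of_loses hv h))
  refine ⟨i, fun w hw => ?_⟩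
  have hvi : 0 ≤ v i := hv.1 i
  set u := Function.update v i w with hu
  have hui : u i = w := by simp [hu]
  have hub : u ∈ Icc 0 vbar := by
    refine ⟨fun j => ?_, fun j => ?_⟩ <;> by_cases hj : j = i
    · subst hj; rw [hui]; exact hvi.trans hw.1
    · rw [hu, Function.update_of_ne hj]; exact hv.1 j
    · subst hj; rw [hui]; exact hw.2
    · rw [hu, Function.update_of_ne hj]; exact hv.2 j
  have hti := M.t_le hv i
  have d1 := M.dsic v hv i w ⟨hvi.trans hw.1, hw.2⟩
  have d2 := M.dsic u hub i (v i) ⟨hvi, hv.2 i⟩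
  rw [← hu, hxi] at d1
  rw [hu, Function.update_idem, Function.update_eq_self, ← hu, hui, hxi] at d2
  rcases M.deterministic i u hub with hx | hx
  · rw [hx] at d1 d2
    have hwv : w = v i := le_antisymm (by linarith) hw.1
    rw [hu, hwv, Function.update_eq_self, hxi] at hx
    exact absurd hx one_ne_zero
  · rw [hx] at d1 d2
    have hother : ∀ j ≠ i, M.t j u ≤ 0 := by
      intro j hj
      refine M.t_nonpos_of_loses hub ((M.deterministic j u hub).resolve_right fun h1 => ?_)
      have hs := M.supply u hub
      rw [Fin.sum_univ_two] at hs
      have : M.x 0 u = 1 ∧ M.x 1 u = 1 := by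
        fin_cases i <;> fin_cases j <;> simp_all
      linarith [this.1, this.2]
    rw [totalTransfer, ← Finset.add_sum_erase _ _ (Finset.mem_univ i)]
    have := Finset.sum_nonpos fun j (hj : j ∈ Finset.univ.erase i) =>
      hother j (Finset.ne_of_mem_erase hj)
    linarith

/-- A positive minorant cannot exceed `y` after bidder 1's value `y` is raised and also exceed `z`
after bidder 2's value `z` is raised: one of the bidders wins at `(y, z)`. -/
lemma IsMinorant.not_exceeds {M : Mechanism vbar} {c p q : ℝ} (h : M.IsMinorant c p q)
    {y z : ℝ} (hy : y ∈ Icc 0 (vbar 0)) (hz : z ∈ Icc 0 (vbar 1))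
    (hpos : 0 < cornerAffine vbar c p q ![y, z])
    (h0 : ∃ w ∈ Icc y (vbar 0), y < cornerAffine vbar c p q ![w, z])
    (h1 : ∃ w ∈ Icc z (vbar 1), z < cornerAffine vbar c p q ![y, w]) : False := by
  have hv := vec_mem_Icc hy hz
  obtain ⟨i, hi⟩ := M.exists_totalTransfer_update_le hv (hpos.trans_le (h _ hv))
  obtain ⟨w0, hw0, h0⟩ := h0
  obtain ⟨w1, hw1, h1⟩ := h1
  fin_cases i
  · have e : Function.update ![y, z] 0 w0 = ![w0, z] := by
      funext j; fin_cases j <;> simp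
    have h2 := hi w0 hw0
    have h3 := h _ (vec_mem_Icc ⟨hy.1.trans hw0.1, hw0.2⟩ hz)
    simp only [Fin.zero_eta, e, Matrix.cons_val_zero] at h2
    linarith
  · have e : Function.update ![y, z] 1 w1 = ![y, w1] := by
      funext j; fin_cases j <;> simp
    have h2 := hi w1 hw1
    have h3 := h _ (vec_mem_Icc hy ⟨hz.1.trans hw1.1, hw1.2⟩)
    simp only [Fin.mk_one, e, Matrix.cons_val_one, Matrix.cons_val_zero] at h2
    linarith

/-- The test point is the pair of pivots, where the minorant would be positive. -/
lemma IsMinorant.corner_le {M : Mechanism vbar} {c p q : ℝ} (h : M.IsMinorant c p q)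
    (h0 : 0 ≤ vbar 0) (h1 : 0 ≤ vbar 1) (hp : 0 ≤ p) (hq : 0 ≤ q) :
    c ≤ pivot (vbar 0) p + pivot (vbar 1) q := by
  by_contra! hc
  have e0 := slope_mul_sub_pivot (V := vbar 0) hp
  have e1 := slope_mul_sub_pivot (V := vbar 1) hq
  have p0 := pivot_mem h0 hp
  have p1 := pivot_mem h1 hq
  refine h.not_exceeds p0 p1 ?_ ⟨_, ⟨p0.2, le_rfl⟩, ?_⟩ ⟨_, ⟨p1.2, le_rfl⟩, ?_⟩ <;>
    simp only [cornerAffine, Matrix.cons_val_zero, Matrix.cons_val_one, sub_self, mul_zero] <;>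
    linarith

/-- The test point is `(criticalValue vbar p, vbar 1)`: for larger `c` the minorant would exceed
`criticalValue vbar p` at the corner and `vbar 1` at the test point itself. -/
lemma IsMinorant.corner_le_criticalValue {M : Mechanism vbar} {c p q : ℝ}
    (h : M.IsMinorant c p q) (h1 : 0 < vbar 1) (h10 : vbar 1 ≤ vbar 0) (hp : 0 ≤ p) :
    c ≤ criticalValue vbar p := by
  by_contra! hc
  have e := mul_sub_criticalValue (vbar := vbar) hp
  have hle := criticalValue_le h10 hp
  have hge : 0 ≤ criticalValue vbar p := h1.le.trans (le_criticalValue h10 hp)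
  refine h.not_exceeds ⟨hge, hle⟩ ⟨h1.le, le_rfl⟩ ?_ ⟨_, ⟨hle, le_rfl⟩, ?_⟩
    ⟨_, ⟨le_rfl, le_rfl⟩, ?_⟩ <;>
    simp only [cornerAffine, Matrix.cons_val_zero, Matrix.cons_val_one, sub_self, mul_zero] <;>
    linarith

/-- A minorant is either admissible or is beaten at `m` by an admissible triple, obtained by
replacing negative slopes by zero. -/
lemma IsMinorant.admissible_or {M : Mechanism vbar} {c p q : ℝ} (h : M.IsMinorant c p q)
    (h1 : 0 < vbar 1) (h10 : vbar 1 ≤ vbar 0) {m : Profile} (hm : ∀ i, m i ∈ Ioo 0 (vbar i)) :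
    Admissible vbar c p q ∨ ∃ c' p' q', Admissible vbar c' p' q' ∧
      cornerAffine vbar c p q m < cornerAffine vbar c' p' q' m := by
  have h0 : 0 < vbar 0 := h1.trans_le h10
  have m0 := (hm 0).1
  have m1 := (hm 1).1
  have crit0 : criticalValue vbar 0 = vbar 1 := by simp [criticalValue]
  have piv0 : ∀ V, pivot V 0 = 0 := by simp [pivot]
  rcases le_or_gt 0 p with a0 | a0 <;> rcases le_or_gt 0 q with a1 | a1
  · exact Or.inl ⟨a0, a1, h.corner_le h0.le h1.le a0 a1, h.corner_le_criticalValue h1 h10 a0⟩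
  · have hpiv := pivot_mem h0.le a0
    have key : c - q * vbar 1 ≤ pivot (vbar 0) p := by
      by_contra! hc
      have e := slope_mul_sub_pivot (V := vbar 0) a0
      refine h.not_exceeds hpiv ⟨le_rfl, h1.le⟩ ?_ ⟨_, ⟨hpiv.2, le_rfl⟩, ?_⟩
        ⟨0, ⟨le_rfl, h1.le⟩, ?_⟩ <;>
      simp only [cornerAffine, Matrix.cons_val_zero, Matrix.cons_val_one, sub_self, mul_zero] <;>
      linarith
    refine Or.inr ⟨c - q * vbar 1, p, 0, ⟨a0, le_rfl, by rw [piv0]; linarith,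
      key.trans (pivot_le_criticalValue h1.le a0)⟩, ?_⟩
    simp only [cornerAffine]
    nlinarith
  · have hpiv := pivot_mem h1.le a1
    have key : c - p * vbar 0 ≤ pivot (vbar 1) q := by
      by_contra! hc
      have e := slope_mul_sub_pivot (V := vbar 1) a1
      refine h.not_exceeds ⟨le_rfl, h0.le⟩ hpiv ?_ ⟨0, ⟨le_rfl, h0.le⟩, ?_⟩
        ⟨_, ⟨hpiv.2, le_rfl⟩, ?_⟩ <;>
      simp only [cornerAffine, Matrix.cons_val_zero, Matrix.cons_val_one, sub_self, mul_zero] <;>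
      linarith
    refine Or.inr ⟨c - p * vbar 0, 0, q, ⟨le_rfl, a1, by rw [piv0]; linarith,
      by rw [crit0]; exact key.trans hpiv.2⟩, ?_⟩
    simp only [cornerAffine]
    nlinarith
  · have key : c - p * vbar 0 - q * vbar 1 ≤ 0 := by
      by_contra! hc
      refine h.not_exceeds ⟨le_rfl, h0.le⟩ ⟨le_rfl, h1.le⟩ ?_ ⟨0, ⟨le_rfl, h0.le⟩, ?_⟩

        ⟨0, ⟨le_rfl, h1.le⟩, ?_⟩ <;>
      simp only [cornerAffine, Matrix.cons_val_zero, Matrix.cons_val_one] <;>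
      linarith
    refine Or.inr ⟨c - p * vbar 0 - q * vbar 1, 0, 0, ⟨le_rfl, le_rfl,
      by rw [piv0, piv0]; linarith, by rw [crit0]; linarith⟩, ?_⟩
    simp only [cornerAffine]
    nlinarith

/-- If the affine function with data `(c, p, q)` is the unique best admissible one at `m` and is a
minorant of some mechanism, the optimal mechanisms are exactly those that it minorizes. -/
lemma isOptimal_iff_isMinorant (h1 : 0 < vbar 1) (h10 : vbar 1 ≤ vbar 0) {m : Profile}
    (hm : ∀ i, m i ∈ Ioo 0 (vbar i)) {c p q : ℝ}
    (hbest : ∀ c' p' q', Admissible vbar c' p' q' →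
      cornerAffine vbar c p q m ≤ cornerAffine vbar c' p' q' m → c' = c ∧ p' = p ∧ q' = q)
    {M₀ : Mechanism vbar} (hM₀ : M₀.IsMinorant c p q) (M : Mechanism vbar) :
    M.IsOptimal m ↔ M.IsMinorant c p q := by
  have key : ∀ (M' : Mechanism vbar) (c' p' q' : ℝ), M'.IsMinorant c' p' q' →
      cornerAffine vbar c p q m ≤ cornerAffine vbar c' p' q' m → c' = c ∧ p' = p ∧ q' = q := by
    intro M' c' p' q' h hle
    rcases h.admissible_or h1 h10 hm with had | ⟨d, s, t, had, hlt⟩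
    · exact hbest _ _ _ had hle
    · obtain ⟨rfl, rfl, rfl⟩ := hbest _ _ _ had (hle.trans hlt.le)
      exact absurd hlt (not_lt.mpr hle)
  constructor
  · intro hM
    obtain ⟨c', p', q', hmin, hval⟩ := M.exists_isMinorant hm
      ((hM₀.le_guarantee m).trans (hM M₀))
    obtain ⟨rfl, rfl, rfl⟩ := key M c' p' q' hmin hval.ge
    exact hmin
  · intro hM M'
    by_contra! hlt
    obtain ⟨g, hg1, hg2⟩ := EReal.lt_iff_exists_real_btwn.mp hlt
    obtain ⟨c', p', q', hmin, hval⟩ := M'.exists_isMinorant hm hg2.le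
    have hg3 := EReal.coe_lt_coe_iff.mp ((hM.le_guarantee m).trans_lt hg1)
    obtain ⟨rfl, rfl, rfl⟩ := key M' c' p' q' hmin (by rw [hval]; exact hg3.le)
    exact absurd hval hg3.ne

end Mechanism

section

variable {vbar : Profile}

/-! ### The best admissible affine function -/

/-- The amount that one bidder with top value `V` and mean `V * (1 - k ^ 2)` contributes to the
value of an affine function that has slope `x` in her direction and vanishes at the pivot. -/
def pivotGain (V k x : ℝ) : ℝ := pivot V x - x * (V * k ^ 2)

/-- `pivotGain V k` is strictly unimodal, with peak at `(1 - k) / k`. -/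
lemma pivotGain_lt {V k x y : ℝ} (hV : 0 < V) (hk : 0 < k) (hx : 0 ≤ x) (hy : 0 ≤ y)
    (hxy : y ∈ uIcc x ((1 - k) / k)) (hne : x ≠ y) : pivotGain V k x < pivotGain V k y := by
  have e : pivotGain V k y - pivotGain V k x
      = V * ((y - x) * (1 - (k * (1 + x)) * (k * (1 + y)))) / ((1 + x) * (1 + y)) := by
    have : 1 + x ≠ 0 := by linarith
    have : 1 + y ≠ 0 := by linarith
    unfold pivotGain pivot
    field_simp
    ring
  rw [← sub_pos, e]
  refine div_pos (mul_pos hV ?_) (by positivity)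
  rcases mem_uIcc.mp hxy with ⟨h1, h2⟩ | ⟨h1, h2⟩
  · rw [le_div_iff₀ hk] at h2
    have hlt := lt_of_le_of_ne h1 hne
    have hy1 : k * (1 + y) ≤ 1 := by linarith
    have hx1 : k * (1 + x) < 1 := by nlinarith
    exact mul_pos (by linarith) (by nlinarith [mul_pos hk (show 0 < 1 + y by linarith)])
  · rw [div_le_iff₀ hk] at h1
    have hlt := lt_of_le_of_ne h2 hne.symm
    have hy1 : 1 ≤ k * (1 + y) := by linarith
    have hx1 : 1 < k * (1 + x) := by nlinarith
    exact mul_pos_of_neg_of_neg (by linarith) (by nlinarith)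

lemma pivotGain_le {V k x y : ℝ} (hV : 0 < V) (hk : 0 < k) (hx : 0 ≤ x) (hy : 0 ≤ y)
    (hxy : y ∈ uIcc x ((1 - k) / k)) : pivotGain V k x ≤ pivotGain V k y := by
  rcases eq_or_ne x y with rfl | hne
  · exact le_rfl
  · exact (pivotGain_lt hV hk hx hy hxy hne).le

lemma cornerAffine_pivot {m : Profile} {k₀ k₁ : ℝ} (h0 : vbar 0 - m 0 = vbar 0 * k₀ ^ 2)
    (h1 : vbar 1 - m 1 = vbar 1 * k₁ ^ 2) (p q : ℝ) :
    cornerAffine vbar (pivot (vbar 0) p + pivot (vbar 1) q) p q m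
      = pivotGain (vbar 0) k₀ p + pivotGain (vbar 1) k₁ q := by
  rw [cornerAffine, h0, h1, pivotGain, pivotGain]
  ring

/-- Under the pivot bound alone the problem separates between the bidders, and each slope sits at
the peak of its bidder's gain. -/
lemma admissible_best_of_low {m : Profile} {k₀ k₁ : ℝ} (hv0 : 0 < vbar 0) (hv1 : 0 < vbar 1)
    (h0 : vbar 0 - m 0 = vbar 0 * k₀ ^ 2) (h1 : vbar 1 - m 1 = vbar 1 * k₁ ^ 2)
    (hk₀ : k₀ ∈ Ioo 0 1) (hk₁ : k₁ ∈ Ioo 0 1) {p q : ℝ} (hp : p = (1 - k₀) / k₀)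
    (hq : q = (1 - k₁) / k₁) (c' p' q' : ℝ) (h : Admissible vbar c' p' q')
    (hle : cornerAffine vbar (pivot (vbar 0) p + pivot (vbar 1) q) p q m
      ≤ cornerAffine vbar c' p' q' m) :
    c' = pivot (vbar 0) p + pivot (vbar 1) q ∧ p' = p ∧ q' = q := by
  have hp0 : 0 ≤ p := hp ▸ div_nonneg (by linarith [hk₀.2]) hk₀.1.le
  have hq0 : 0 ≤ q := hq ▸ div_nonneg (by linarith [hk₁.2]) hk₁.1.le
  have hc := h.le_pivot
  have hle' : cornerAffine vbar c' p' q' m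
      ≤ pivotGain (vbar 0) k₀ p' + pivotGain (vbar 1) k₁ q' := by
    rw [← cornerAffine_pivot h0 h1]
    simp only [cornerAffine]
    linarith
  have hle'' := hle
  rw [cornerAffine_pivot h0 h1] at hle''
  have hup : p ∈ uIcc p' ((1 - k₀) / k₀) := hp ▸ right_mem_uIcc
  have huq : q ∈ uIcc q' ((1 - k₁) / k₁) := hq ▸ right_mem_uIcc
  have gp := pivotGain_le hv0 hk₀.1 h.nonneg_left hp0 hup
  have gq := pivotGain_le hv1 hk₁.1 h.nonneg_right hq0 huq
  have ep : p' = p := by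
    by_contra hne
    linarith [pivotGain_lt hv0 hk₀.1 h.nonneg_left hp0 hup hne]
  have eq : q' = q := by
    by_contra hne
    linarith [pivotGain_lt hv1 hk₁.1 h.nonneg_right hq0 huq hne]
  subst ep eq
  refine ⟨le_antisymm hc ?_, rfl, rfl⟩
  simp only [cornerAffine] at hle
  linarith

/-- From a point below the hyperbola `x * y = 1` one can move coordinatewise towards a point above
it and stop on the hyperbola. -/
lemma exists_mem_uIcc_hyperbola {p q P Q : ℝ} (hQ : 0 < Q) (hp : 0 ≤ p)
    (hpq : p * q < 1) (hPQ : 1 ≤ P * Q) : ∃ x, 0 < x ∧ x ∈ uIcc p P ∧ 1 / x ∈ uIcc q Q := by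
  have hP : 0 < P := pos_of_mul_pos_left (one_pos.trans_le hPQ) hQ.le
  by_cases h : 1 ≤ min p P * Q
  · have hx : 0 < min p P := pos_of_mul_pos_left (one_pos.trans_le h) hQ.le
    refine ⟨min p P, hx, ⟨le_rfl, min_le_max⟩, mem_uIcc.mpr (Or.inl ⟨?_, ?_⟩)⟩
    · rw [le_div_iff₀ hx]
      rcases le_or_gt q 0 with hq | hq
      · nlinarith
      · nlinarith [min_le_left p P]
    · rw [div_le_iff₀ hx]; linarith
  · push Not at h
    have hlt : min p P < P := by
      by_contra! h'
      nlinarith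
    have hmin : min p P = p := by
      rcases min_choice p P with h' | h'
      · exact h'
      · exact absurd h' hlt.ne
    rw [hmin] at h
    refine ⟨1 / Q, by positivity, mem_uIcc.mpr (Or.inl ⟨?_, ?_⟩), by simp⟩
    · rw [le_div_iff₀ hQ]; exact h.le
    · rw [div_le_iff₀ hQ]; exact hPQ

/-- On the hyperbola of slopes `(x, 1 / x)` the value at the mean has its strict maximum at the
solution of the slope equation, which is its first-order condition. -/
lemma cornerAffine_hyperbola_lt {m : Profile} (h10 : vbar 1 ≤ vbar 0) (hm1 : m 1 < vbar 1)
    {g x : ℝ} (hg : 0 < g) (hgs : SlopeEquation vbar m g) (hx : 0 < x) (hne : x ≠ g) :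
    cornerAffine vbar (criticalValue vbar x) x (1 / x) m
      < cornerAffine vbar (criticalValue vbar g) g (1 / g) m := by
  have e : cornerAffine vbar (criticalValue vbar g) g (1 / g) m
      - cornerAffine vbar (criticalValue vbar x) x (1 / x) m
      = (x - g) ^ 2 * ((vbar 0 - vbar 1) / ((x + 1) * (g + 1) ^ 2)
        + (vbar 1 - m 1) / (x * g ^ 2)) := by
    simp only [cornerAffine, criticalValue]
    rw [← hgs]
    field_simp
    ring
  rw [← sub_pos, e]
  have h1 : 0 < (x - g) ^ 2 := by
    have := sub_ne_zero.mpr hne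
    positivity
  have h2 : 0 ≤ vbar 0 - vbar 1 := by linarith
  have h3 : 0 < vbar 1 - m 1 := by linarith
  positivity

/-- For high means the peaks of the two gains lie on or above the hyperbola `p * q = 1`. Below the
hyperbola the pivot bound applies, and moving towards the peaks up to the hyperbola increases the
value. On or above it the bound by the critical value applies, and lowering `q` to the hyperbola
increases the value. On the hyperbola the two bounds agree. -/
lemma admissible_best_of_high {m : Profile} {k₀ k₁ : ℝ} (hv1 : 0 < vbar 1)
    (h10 : vbar 1 ≤ vbar 0) (hm1 : m 1 < vbar 1)
    (h0 : vbar 0 - m 0 = vbar 0 * k₀ ^ 2) (h1 : vbar 1 - m 1 = vbar 1 * k₁ ^ 2)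
    (hk₀ : k₀ ∈ Ioo 0 1) (hk₁ : k₁ ∈ Ioo 0 1) (hk : k₀ + k₁ ≤ 1) {g : ℝ} (hg : 0 < g)
    (hgs : SlopeEquation vbar m g) (c' p' q' : ℝ) (h : Admissible vbar c' p' q')
    (hle : cornerAffine vbar (criticalValue vbar g) g (1 / g) m
      ≤ cornerAffine vbar c' p' q' m) :
    c' = criticalValue vbar g ∧ p' = g ∧ q' = 1 / g := by
  have hv0 : 0 < vbar 0 := hv1.trans_le h10
  have hp := h.nonneg_left
  have hq := h.nonneg_right
  rcases lt_or_ge (p' * q') 1 with hpq | hpq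
  · exfalso
    obtain ⟨x, hx, hx0, hx1⟩ := exists_mem_uIcc_hyperbola (P := (1 - k₀) / k₀)
      (Q := (1 - k₁) / k₁) (div_pos (by linarith [hk₁.2]) hk₁.1) hp hpq (by
        rw [div_mul_div_comm, le_div_iff₀ (mul_pos hk₀.1 hk₁.1)]
        linarith)
    have hx' : 0 ≤ 1 / x := by positivity
    have g0 := pivotGain_le hv0 hk₀.1 hp hx.le hx0
    have g1 := pivotGain_le hv1 hk₁.1 hq hx' hx1
    have hlt : pivotGain (vbar 0) k₀ p' + pivotGain (vbar 1) k₁ q'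
        < pivotGain (vbar 0) k₀ x + pivotGain (vbar 1) k₁ (1 / x) := by
      by_cases hne : p' = x
      · have hne' : q' ≠ 1 / x := by
          rintro rfl
          rw [hne, mul_one_div_cancel hx.ne'] at hpq
          exact lt_irrefl _ hpq
        linarith [pivotGain_lt hv1 hk₁.1 hq hx' hx1 hne']
      · linarith [pivotGain_lt hv0 hk₀.1 hp hx.le hx0 hne]
    rw [← cornerAffine_pivot h0 h1, ← cornerAffine_pivot h0 h1, pivot_add_pivot_inv hx] at hlt
    have hle' : cornerAffine vbar (criticalValue vbar x) x (1 / x) m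
        ≤ cornerAffine vbar (criticalValue vbar g) g (1 / g) m := by
      rcases eq_or_ne x g with rfl | hne
      · exact le_rfl
      · exact (cornerAffine_hyperbola_lt h10 hm1 hg hgs hx hne).le
    have hc := h.le_pivot
    simp only [cornerAffine] at hle hlt hle'
    linarith
  · have hp0 : 0 < p' := pos_of_mul_pos_left (one_pos.trans_le hpq) hq
    have hq0 : 1 / p' ≤ q' := by rw [div_le_iff₀ hp0]; linarith
    have hc := h.le_criticalValue
    have hmu : 0 < vbar 1 - m 1 := by linarith
    have hle' : cornerAffine vbar c' p' q' m
        ≤ cornerAffine vbar (criticalValue vbar p') p' (1 / p') m := by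
      have := mul_le_mul_of_nonneg_right hq0 hmu.le
      simp only [cornerAffine]
      linarith
    have ep : p' = g := by
      by_contra hne
      linarith [cornerAffine_hyperbola_lt h10 hm1 hg hgs hp0 hne]
    subst ep
    simp only [cornerAffine] at hle
    have hq1 : q' ≤ 1 / p' := by
      refine le_of_mul_le_mul_right ?_ hmu
      linarith
    have eq : q' = 1 / p' := le_antisymm hq1 hq0
    subst eq
    exact ⟨le_antisymm hc (by linarith), rfl, rfl⟩

lemma slopeEquation_unique {m : Profile} (h10 : vbar 1 ≤ vbar 0) (hm1 : m 1 < vbar 1) {x y : ℝ}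
    (hx : 0 < x) (hy : 0 < y) (hxs : SlopeEquation vbar m x) (hys : SlopeEquation vbar m y) :
    x = y := by
  by_contra hne
  exact lt_asymm (cornerAffine_hyperbola_lt h10 hm1 hx hxs hy (Ne.symm hne))
    (cornerAffine_hyperbola_lt h10 hm1 hy hys hx hne)

lemma exists_slopeEquation {m : Profile} (h10 : vbar 1 ≤ vbar 0) (hm0 : m 0 < vbar 0)
    (hm1 : m 1 < vbar 1) : ∃ g, 0 < g ∧ SlopeEquation vbar m g := by
  set A := vbar 0 - vbar 1 with hA
  set B := vbar 1 - m 1 with hB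
  set C := vbar 0 - m 0 with hC
  have hA0 : 0 ≤ A := by linarith
  have hB0 : 0 < B := by linarith
  have hC0 : 0 < C := by linarith
  -- At `√(B / C)` the second summand alone is `C`; at `√((A + B) / C)` the sum is at most `C`.
  set x := √(B / C) with hx
  set y := √((A + B) / C) with hy
  have hx0 : 0 < x := by positivity
  have hxy : x ≤ y := Real.sqrt_le_sqrt (by gcongr; linarith)
  have hy0 : 0 < y := hx0.trans_le hxy
  have hcont : ContinuousOn (fun z : ℝ => A / (z + 1) ^ 2 + B / z ^ 2) (Icc x y) := by
    refine ContinuousOn.add (ContinuousOn.div (by fun_prop) (by fun_prop) ?_)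
      (ContinuousOn.div (by fun_prop) (by fun_prop) ?_)
    · intro z hz
      have : 0 < z := hx0.trans_le hz.1
      positivity
    · intro z hz
      have : 0 < z := hx0.trans_le hz.1
      positivity
  have hex : C ≤ A / (x + 1) ^ 2 + B / x ^ 2 := by
    have e : B / x ^ 2 = C := by
      rw [hx, Real.sq_sqrt (by positivity)]; field_simp
    rw [e]
    have : 0 ≤ A / (x + 1) ^ 2 := by positivity
    linarith
  have hey : A / (y + 1) ^ 2 + B / y ^ 2 ≤ C := by
    have e : A / y ^ 2 + B / y ^ 2 = C := by
      rw [← add_div, hy, Real.sq_sqrt (by positivity)]; field_simp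
    rw [← e]
    gcongr
    linarith
  obtain ⟨g, hg, hgC⟩ := intermediate_value_Icc' hxy hcont ⟨hey, hex⟩
  exact ⟨g, hx0.trans_le hg.1, hgC⟩

end

namespace Mechanism

variable {vbar : Profile}

/-! ### Linear score auctions -/

lemma IsLSA.x_zero_eq_one {M : Mechanism vbar} {γ : ℝ} {r : Profile} (h : M.IsLSA γ r)
    {v : Profile} (hv : v ∈ Icc 0 vbar) (hs : max (v 1 - r 1) 0 < γ * (v 0 - r 0)) :
    M.x 0 v = 1 := by
  refine h.wins v hv 0 1 (by decide) ?_
  simp only [Matrix.cons_val_zero, Matrix.cons_val_one, one_mul]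
  linarith

lemma IsLSA.x_zero_eq_zero {M : Mechanism vbar} {γ : ℝ} {r : Profile} (h : M.IsLSA γ r)
    {v : Profile} (hv : v ∈ Icc 0 vbar) (hs : γ * (v 0 - r 0) < max (v 1 - r 1) 0) :
    M.x 0 v = 0 := by
  refine h.loses v hv 0 1 (by decide) ?_
  simp only [Matrix.cons_val_zero, Matrix.cons_val_one, one_mul]
  linarith

lemma IsLSA.x_one_eq_zero {M : Mechanism vbar} {γ : ℝ} {r : Profile} (h : M.IsLSA γ r)
    {v : Profile} (hv : v ∈ Icc 0 vbar) (hs : v 1 - r 1 < max (γ * (v 0 - r 0)) 0) :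
    M.x 1 v = 0 := by
  refine h.loses v hv 1 0 (by decide) ?_
  simp only [Matrix.cons_val_zero, Matrix.cons_val_one, one_mul]
  rwa [← mul_sub]

lemma IsLSA.totalTransfer_eq {M : Mechanism vbar} {γ : ℝ} {r : Profile} (h : M.IsLSA γ r)
    (hγ : 0 < γ) {v : Profile} (hv : v ∈ Icc 0 vbar) :
    M.totalTransfer v = M.x 0 v * (r 0 + max (v 1 - r 1) 0 / γ)
      + M.x 1 v * (r 1 + max (γ * (v 0 - r 0)) 0) := by
  have h0 := h.pays v hv 0 1 (by decide)
  have h1 := h.pays v hv 1 0 (by decide)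
  simp only [Matrix.cons_val_zero, Matrix.cons_val_one, one_mul, div_one, ← mul_sub] at h0 h1
  rw [totalTransfer, Fin.sum_univ_two, h0, h1, add_div, mul_div_cancel_left₀ _ hγ.ne']

lemma IsLSA.totalTransfer_unsold {M : Mechanism vbar} {γ : ℝ} {r : Profile} (h : M.IsLSA γ r)
    (hγ : 0 < γ) {v : Profile} (hv : v ∈ Icc 0 vbar) (h0 : v 0 < r 0) (h1 : v 1 < r 1) :
    M.totalTransfer v = 0 := by
  have hs0 : γ * (v 0 - r 0) < 0 := mul_neg_of_pos_of_neg hγ (by linarith)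
  rw [h.totalTransfer_eq hγ hv, h.x_zero_eq_zero hv (hs0.trans_le (le_max_right _ _)),
    h.x_one_eq_zero hv ((show v 1 - r 1 < 0 by linarith).trans_le (le_max_right _ _))]
  ring

lemma IsLSA.sum_x {M : Mechanism vbar} {γ : ℝ} {r : Profile} (h : M.IsLSA γ r)
    {v : Profile} (hv : v ∈ Icc 0 vbar) (hs : 0 ≤ γ * (v 0 - r 0) ∨ 0 ≤ v 1 - r 1) :
    M.x 0 v + M.x 1 v = 1 := by
  rw [← Fin.sum_univ_two fun i => M.x i v]
  refine h.sold v hv ?_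
  rcases hs with hs | hs
  · exact ⟨0, by simp only [Matrix.cons_val_zero]; linarith⟩
  · exact ⟨1, by simp only [Matrix.cons_val_one, Matrix.cons_val_zero, one_mul]; linarith⟩

lemma IsLSA.totalTransfer_left {M : Mechanism vbar} {γ : ℝ} {r : Profile} (h : M.IsLSA γ r)
    (hγ : 0 < γ) {v : Profile} (hv : v ∈ Icc 0 vbar)
    (hs : max (v 1 - r 1) 0 < γ * (v 0 - r 0)) :
    M.totalTransfer v = r 0 + max (v 1 - r 1) 0 / γ := by
  have hx := h.x_zero_eq_one hv hs
  have hsum := h.sum_x hv (Or.inl ((le_max_right _ _).trans hs.le))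
  have hx1 : M.x 1 v = 0 := by linarith
  rw [h.totalTransfer_eq hγ hv, hx, hx1]
  ring

lemma IsLSA.totalTransfer_right {M : Mechanism vbar} {γ : ℝ} {r : Profile} (h : M.IsLSA γ r)
    (hγ : 0 < γ) {v : Profile} (hv : v ∈ Icc 0 vbar)
    (hs : max (γ * (v 0 - r 0)) 0 < v 1 - r 1) :
    M.totalTransfer v = r 1 + max (γ * (v 0 - r 0)) 0 := by
  have hx := h.x_zero_eq_zero hv
    ((le_max_left _ _).trans_lt hs |>.trans_le (le_max_left _ _))
  have hsum := h.sum_x hv (Or.inr ((le_max_right _ _).trans hs.le))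
  have hx1 : M.x 1 v = 1 := by linarith
  rw [h.totalTransfer_eq hγ hv, hx, hx1]
  ring

/-- An affine function lies below the revenue of a linear score auction as soon as it does so for
each way the object may go to a bidder of weakly highest nonnegative score, or stay unsold. -/
lemma IsLSA.isMinorant_of {M : Mechanism vbar} {γ : ℝ} {r : Profile} (h : M.IsLSA γ r)
    (hγ : 0 < γ) {c p q : ℝ}
    (hun : ∀ v ∈ Icc 0 vbar, v 0 < r 0 → v 1 < r 1 → cornerAffine vbar c p q v ≤ 0)
    (hleft : ∀ v ∈ Icc 0 vbar, max (v 1 - r 1) 0 ≤ γ * (v 0 - r 0) →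
      cornerAffine vbar c p q v ≤ r 0 + max (v 1 - r 1) 0 / γ)
    (hright : ∀ v ∈ Icc 0 vbar, max (γ * (v 0 - r 0)) 0 ≤ v 1 - r 1 →
      cornerAffine vbar c p q v ≤ r 1 + max (γ * (v 0 - r 0)) 0) :
    M.IsMinorant c p q := by
  intro v hv
  by_cases hs : 0 ≤ γ * (v 0 - r 0) ∨ 0 ≤ v 1 - r 1
  · have hsum := h.sum_x hv hs
    rw [h.totalTransfer_eq hγ hv]
    rcases M.deterministic 0 v hv with hx | hx
    · have hx1 : M.x 1 v = 1 := by linarith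
      rw [hx, hx1, zero_mul, one_mul, zero_add]
      refine hright v hv ?_
      by_contra! hlt
      rw [h.x_one_eq_zero hv hlt] at hx1
      exact zero_ne_one hx1
    · have hx1 : M.x 1 v = 0 := by linarith
      rw [hx, hx1, zero_mul, one_mul, add_zero]
      refine hleft v hv ?_
      by_contra! hlt
      rw [h.x_zero_eq_zero hv hlt] at hx
      exact zero_ne_one hx
  · push Not at hs
    have h0 : v 0 < r 0 := by
      by_contra! h'
      exact absurd hs.1 (not_lt.mpr (mul_nonneg hγ.le (by linarith)))
    have h1 : v 1 < r 1 := by linarith [hs.2]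
    rw [h.totalTransfer_unsold hγ hv h0 h1]
    exact hun v hv h0 h1

/-! ### Existence of linear score auctions -/

/-- The winning threshold of each bidder in the linear score auction with slope `γ` and prices
`r`. -/
def scoreThreshold (γ : ℝ) (r : Profile) (i : Fin 2) (v : Profile) : ℝ :=
  ![r 0 + max (v 1 - r 1) 0 / γ, r 1 + max (γ * (v 0 - r 0)) 0] i

open Classical in
/-- The allocation of the linear score auction with slope `γ` and prices `r` in which bidder 1 wins
ties between nonnegative scores. -/
def scoreAllocation (γ : ℝ) (r : Profile) (i : Fin 2) (v : Profile) : ℝ :=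
  ![if 0 ≤ γ * (v 0 - r 0) ∧ v 1 - r 1 ≤ γ * (v 0 - r 0) then 1 else 0,
    if 0 ≤ v 1 - r 1 ∧ γ * (v 0 - r 0) < v 1 - r 1 then 1 else 0] i

lemma scoreAllocation_zero_or_one (γ : ℝ) (r : Profile) (i : Fin 2) (v : Profile) :
    scoreAllocation γ r i v = 0 ∨ scoreAllocation γ r i v = 1 := by
  fin_cases i
  · by_cases h : 0 ≤ γ * (v 0 - r 0) ∧ v 1 - r 1 ≤ γ * (v 0 - r 0) <;>
      simp [scoreAllocation, -sub_nonneg, -tsub_le_iff_right, h]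
  · by_cases h : 0 ≤ v 1 - r 1 ∧ γ * (v 0 - r 0) < v 1 - r 1 <;>
      simp [scoreAllocation, -sub_nonneg, h]

lemma scoreThreshold_update (γ : ℝ) (r : Profile) (i : Fin 2) (v : Profile) (w : ℝ) :
    scoreThreshold γ r i (Function.update v i w) = scoreThreshold γ r i v := by
  fin_cases i <;> simp [scoreThreshold]

lemma scoreThreshold_le_of_wins {γ : ℝ} (hγ : 0 < γ) {r : Profile} {i : Fin 2} {v : Profile}
    (h : scoreAllocation γ r i v = 1) : scoreThreshold γ r i v ≤ v i := by
  fin_cases i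
  · by_cases h' : 0 ≤ γ * (v 0 - r 0) ∧ v 1 - r 1 ≤ γ * (v 0 - r 0)
    · have : max (v 1 - r 1) 0 / γ ≤ v 0 - r 0 := by
        rw [div_le_iff₀ hγ, mul_comm]; exact max_le h'.2 h'.1
      simp [scoreThreshold]; linarith
    · simp [scoreAllocation, -tsub_le_iff_right, h'] at h
  · by_cases h' : 0 ≤ v 1 - r 1 ∧ γ * (v 0 - r 0) < v 1 - r 1
    · have : max (γ * (v 0 - r 0)) 0 ≤ v 1 - r 1 := max_le h'.2.le h'.1
      simp [scoreThreshold]; linarith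
    · simp [scoreAllocation, -sub_nonneg, h'] at h

lemma le_scoreThreshold_of_loses {γ : ℝ} (hγ : 0 < γ) {r : Profile} {i : Fin 2} {v : Profile}
    (h : scoreAllocation γ r i v = 0) : v i ≤ scoreThreshold γ r i v := by
  fin_cases i
  · by_cases h' : 0 ≤ γ * (v 0 - r 0) ∧ v 1 - r 1 ≤ γ * (v 0 - r 0)
    · simp [scoreAllocation, h'] at h
    · have : v 0 - r 0 ≤ max (v 1 - r 1) 0 / γ := by
        rw [le_div_iff₀ hγ, mul_comm, le_max_iff]
        by_contra! h''
        exact h' ⟨h''.2.le, h''.1.le⟩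
      simp [scoreThreshold]; linarith
  · by_cases h' : 0 ≤ v 1 - r 1 ∧ γ * (v 0 - r 0) < v 1 - r 1
    · simp [scoreAllocation, h'] at h
    · have : v 1 - r 1 ≤ max (γ * (v 0 - r 0)) 0 := by
        rw [le_max_iff]
        by_contra! h''
        exact h' ⟨h''.2.le, h''.1⟩
      simp [scoreThreshold]; linarith

lemma measurable_scoreAllocation (γ : ℝ) (r : Profile) (i : Fin 2) :
    Measurable (scoreAllocation γ r i) := by
  have m0 : Measurable fun v : Profile => γ * (v 0 - r 0) := by fun_prop
  have m1 : Measurable fun v : Profile => v 1 - r 1 := by fun_prop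
  fin_cases i
  · exact Measurable.ite ((measurableSet_le measurable_const m0).inter (measurableSet_le m1 m0))
      measurable_const measurable_const
  · exact Measurable.ite ((measurableSet_le measurable_const m1).inter (measurableSet_lt m0 m1))
      measurable_const measurable_const

lemma measurable_scoreThreshold (γ : ℝ) (r : Profile) (i : Fin 2) :
    Measurable (scoreThreshold γ r i) := by
  have m0 : Measurable fun v : Profile => γ * (v 0 - r 0) := by fun_prop
  have m1 : Measurable fun v : Profile => v 1 - r 1 := by fun_prop
  fin_cases i
  · exact ((m1.max measurable_const).div_const γ).const_add _
  · exact (m0.max measurable_const).const_add _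

/-- The linear score auction in which bidder 1 wins ties between nonnegative scores. -/
def scoreAuction (vbar : Profile) {γ : ℝ} (hγ : 0 < γ) (r : Profile) : Mechanism vbar where
  x := scoreAllocation γ r
  t i v := scoreAllocation γ r i v * scoreThreshold γ r i v
  measurable_x := measurable_scoreAllocation γ r
  measurable_t i := (measurable_scoreAllocation γ r i).mul (measurable_scoreThreshold γ r i)
  deterministic i v _ := scoreAllocation_zero_or_one γ r i v
  supply v _ := by
    by_cases h : γ * (v 0 - r 0) < v 1 - r 1
    · simp only [Fin.sum_univ_two, scoreAllocation, Matrix.cons_val_zero, Matrix.cons_val_one]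
      rw [if_neg fun h' => absurd h (not_lt.mpr h'.2)]
      split_ifs <;> norm_num
    · simp only [Fin.sum_univ_two, scoreAllocation, Matrix.cons_val_zero, Matrix.cons_val_one]
      rw [if_neg (c := _ ∧ γ * (v 0 - r 0) < v 1 - r 1) fun h' => h h'.2]
      split_ifs <;> norm_num
  dsic v _ i w _ := by
    rw [scoreThreshold_update]
    rcases scoreAllocation_zero_or_one γ r i v with h | h <;>
    rcases scoreAllocation_zero_or_one γ r i (Function.update v i w) with h' | h' <;>
    rw [h, h']
    · have := le_scoreThreshold_of_loses hγ h
      linarith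
    · have := scoreThreshold_le_of_wins hγ h
      linarith
  ir v _ i := by
    rcases scoreAllocation_zero_or_one γ r i v with h | h <;> rw [h]
    · simp
    · have := scoreThreshold_le_of_wins hγ h
      linarith

lemma scoreAuction_isLSA {γ : ℝ} (hγ : 0 < γ) {r : Profile} (hr : r ∈ Icc 0 vbar) :
    (scoreAuction vbar hγ r).IsLSA γ r where
  α_nonneg i := by
    have h0 : 0 ≤ r 0 := hr.1 0
    have h1 : 0 ≤ r 1 := hr.1 1
    fin_cases i
    · simpa using mul_nonneg hγ.le h0
    · simpa using h1
  β_pos i := by fin_cases i <;> simp [hγ]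
  wins v _ i j hij h := by
    fin_cases i <;> fin_cases j <;>
      simp only [Fin.zero_eta, Fin.mk_one, ne_eq, not_true_eq_false, Matrix.cons_val_zero,
        Matrix.cons_val_one, one_mul, ← mul_sub, max_lt_iff] at hij h ⊢
    · exact if_pos ⟨h.2.le, h.1.le⟩
    · exact if_pos ⟨h.2.le, h.1⟩
  loses v _ i j hij h := by
    fin_cases i <;> fin_cases j <;>
      simp only [Fin.zero_eta, Fin.mk_one, ne_eq, not_true_eq_false, Matrix.cons_val_zero,
        Matrix.cons_val_one, one_mul, ← mul_sub, lt_max_iff] at hij h ⊢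
    · refine if_neg fun h' => ?_
      rcases h with h | h
      · exact absurd h (not_lt.mpr h'.2)
      · exact absurd h (not_lt.mpr h'.1)
    · refine if_neg fun h' => ?_
      rcases h with h | h
      · exact lt_asymm h h'.2
      · exact absurd h (not_lt.mpr h'.1)
  sold v _ h := by
    have h' : 0 ≤ γ * (v 0 - r 0) ∨ 0 ≤ v 1 - r 1 := by
      obtain ⟨i, hi⟩ := h
      fin_cases i
      · left; simp only [Fin.zero_eta, Matrix.cons_val_zero] at hi; linarith
      · right; simp only [Fin.mk_one, Matrix.cons_val_one, Matrix.cons_val_zero] at hi; linarith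
    simp only [Fin.sum_univ_two, scoreAuction, scoreAllocation, Matrix.cons_val_zero,
      Matrix.cons_val_one]
    rcases lt_or_ge (γ * (v 0 - r 0)) (v 1 - r 1) with hlt | hge
    · have h1 : 0 ≤ v 1 - r 1 := h'.elim (fun h0 => h0.trans hlt.le) id
      rw [if_neg fun h => absurd hlt (not_lt.mpr h.2), if_pos ⟨h1, hlt⟩, zero_add]
    · have h0 : 0 ≤ γ * (v 0 - r 0) := h'.elim id fun h1 => h1.trans hge
      rw [if_pos ⟨h0, hge⟩, if_neg fun h => absurd h.2 (not_lt.mpr hge), add_zero]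
  pays v _ i j hij := by
    fin_cases i <;> fin_cases j <;>
      simp only [Fin.zero_eta, Fin.mk_one, ne_eq, not_true_eq_false, Matrix.cons_val_zero,
        Matrix.cons_val_one, one_mul, div_one, ← mul_sub, scoreAuction, scoreThreshold] at hij ⊢
    rw [add_div, mul_div_cancel_left₀ _ hγ.ne']

/-! ### Which linear score auctions have a given minorant -/

/-- If both prices exceed the pivots, the object is unsold at some points where the affine function
is positive. -/
lemma IsLSA.not_isMinorant_of_pivot_lt {M : Mechanism vbar} {γ : ℝ} {r : Profile}
    (h : M.IsLSA γ r) (hγ : 0 < γ) (hr : r ∈ Icc 0 vbar) (h0 : 0 ≤ vbar 0) (h1 : 0 ≤ vbar 1)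
    {p q : ℝ} (hp : 0 < p) (hq : 0 < q)
    (hr0 : pivot (vbar 0) p < r 0) (hr1 : pivot (vbar 1) q < r 1) :
    ¬ M.IsMinorant (pivot (vbar 0) p + pivot (vbar 1) q) p q := by
  intro hmin
  have p0 := pivot_mem h0 hp.le
  have p1 := pivot_mem h1 hq.le
  have r0 : r 0 ≤ vbar 0 := hr.2 0
  have r1 : r 1 ≤ vbar 1 := hr.2 1
  have hv : ![(pivot (vbar 0) p + r 0) / 2, (pivot (vbar 1) q + r 1) / 2] ∈ Icc 0 vbar := by
    constructor <;> intro i <;> fin_cases i <;> simp <;> linarith [p0.1, p1.1]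
  have hle := hmin _ hv
  rw [h.totalTransfer_unsold hγ hv (by simp; linarith) (by simp; linarith),
    cornerAffine_pivot_eq hp.le hq.le] at hle
  simp only [Matrix.cons_val_zero, Matrix.cons_val_one] at hle
  nlinarith

/-- A minorant is at most the payment of bidder 1 where she wins against a value of bidder 2 that is
at least his price. -/
lemma IsLSA.minorant_le_left {M : Mechanism vbar} {γ : ℝ} {r : Profile} (h : M.IsLSA γ r)
    (hγ : 0 < γ) {c p q : ℝ} (hmin : M.IsMinorant c p q) {y z : ℝ} (hy : y ∈ Icc 0 (vbar 0))
    (hz : z ∈ Icc 0 (vbar 1)) (hrz : r 1 ≤ z) (hr : r 0 < y) (hyz : z - r 1 < γ * (y - r 0)) :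
    cornerAffine vbar c p q ![y, z] ≤ r 0 + (z - r 1) / γ := by
  have hpos := mul_pos hγ (sub_pos.mpr hr)
  have e := h.totalTransfer_left hγ (vec_mem_Icc hy hz)
    (by simpa using ⟨by linarith, hpos⟩)
  simp only [Matrix.cons_val_one, Matrix.cons_val_zero, max_eq_left (sub_nonneg.mpr hrz)] at e
  rw [← e]
  exact hmin _ (vec_mem_Icc hy hz)

lemma IsLSA.minorant_le_right {M : Mechanism vbar} {γ : ℝ} {r : Profile} (h : M.IsLSA γ r)
    (hγ : 0 < γ) {c p q : ℝ} (hmin : M.IsMinorant c p q) {y z : ℝ} (hy : y ∈ Icc 0 (vbar 0))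
    (hz : z ∈ Icc 0 (vbar 1)) (hry : r 0 ≤ y) (hyz : γ * (y - r 0) < z - r 1) :
    cornerAffine vbar c p q ![y, z] ≤ r 1 + γ * (y - r 0) := by
  have hpos := mul_nonneg hγ.le (sub_nonneg.mpr hry)
  have e := h.totalTransfer_right hγ (vec_mem_Icc hy hz)
    (by simpa using ⟨by linarith, by linarith⟩)
  simp only [Matrix.cons_val_zero, max_eq_left hpos] at e
  rw [← e]
  exact hmin _ (vec_mem_Icc hy hz)

/-- The minorant with slopes `p * q < 1`. Necessity: payments at `(vbar 0, r 1)` and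
`(r 0, vbar 1)` show that a price above its pivot forces the other price above its pivot, which the
unsold region excludes; then the same two inequalities and `p * q < 1` give equality. Payments for
slightly larger values of the loser compare the slopes with `γ`. -/
lemma IsLSA.isMinorant_iff_of_mul_lt_one {M : Mechanism vbar} {γ : ℝ} {r : Profile}
    (h : M.IsLSA γ r) (hγ : 0 < γ) (hr : r ∈ Icc 0 vbar) (h0 : 0 < vbar 0) (h1 : 0 < vbar 1)
    {p q : ℝ} (hp : 0 < p) (hq : 0 < q) (hpq : p * q < 1) :
    M.IsMinorant (pivot (vbar 0) p + pivot (vbar 1) q) p q ↔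
      (r 0 = pivot (vbar 0) p ∧ r 1 = pivot (vbar 1) q) ∧ p ≤ γ ∧ γ ≤ 1 / q := by
  have e0 := slope_mul_sub_pivot (V := vbar 0) hp.le
  have e1 := slope_mul_sub_pivot (V := vbar 1) hq.le
  have p0 := pivot_mem h0.le hp.le
  have p1 := pivot_mem h1.le hq.le
  have l0 : pivot (vbar 0) p < vbar 0 := by
    rw [pivot, div_lt_iff₀ (by linarith)]; linarith
  have l1 : pivot (vbar 1) q < vbar 1 := by
    rw [pivot, div_lt_iff₀ (by linarith)]; linarith
  have r0 : r 0 ≤ vbar 0 := hr.2 0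
  have r1 : r 1 ≤ vbar 1 := hr.2 1
  have r0' : 0 ≤ r 0 := hr.1 0
  have r1' : 0 ≤ r 1 := hr.1 1
  set ρ := pivot (vbar 0) p
  set σ := pivot (vbar 1) q
  constructor
  · intro hmin
    have hleft : ∀ s ∈ Icc 0 (vbar 0), ∀ t ∈ Icc 0 (vbar 1), r 0 < s → r 1 ≤ t →
        t - r 1 < γ * (s - r 0) → p * (s - ρ) + q * (t - σ) ≤ r 0 + (t - r 1) / γ := by
      intro s hs t ht hrs hrt hst
      have := h.minorant_le_left hγ hmin hs ht hrt hrs hst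
      rwa [cornerAffine_pivot_eq hp.le hq.le] at this
    have hright : ∀ s ∈ Icc 0 (vbar 0), ∀ t ∈ Icc 0 (vbar 1), r 0 ≤ s → γ * (s - r 0) < t - r 1 →
        p * (s - ρ) + q * (t - σ) ≤ r 1 + γ * (s - r 0) := by
      intro s hs t ht hrs hst
      have := h.minorant_le_right hγ hmin hs ht hrs hst
      rwa [cornerAffine_pivot_eq hp.le hq.le] at this
    -- `A` and `B` compare the minorant with the winner's payment at `(vbar 0, r 1)` and
    -- `(r 0, vbar 1)`.
    have A : r 0 < vbar 0 → q * (r 1 - σ) ≤ r 0 - ρ := by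
      intro hlt
      have := hleft _ ⟨h0.le, le_rfl⟩ (r 1) ⟨r1', r1⟩ hlt le_rfl
        (by rw [sub_self]; exact mul_pos hγ (by linarith))
      rw [sub_self, zero_div] at this
      linarith
    have B : r 1 < vbar 1 → p * (r 0 - ρ) ≤ r 1 - σ := by
      intro hlt
      have := hright (r 0) ⟨r0', r0⟩ _ ⟨h1.le, le_rfl⟩ le_rfl
        (by rw [sub_self, mul_zero]; linarith)
      rw [sub_self, mul_zero] at this
      linarith
    have hnot : ¬ (ρ < r 0 ∧ σ < r 1) := fun hlt =>
      h.not_isMinorant_of_pivot_lt hγ hr h0.le h1.le hp hq hlt.1 hlt.2 hmin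
    have hle : r 0 ≤ ρ ∧ r 1 ≤ σ := by
      rcases le_or_gt (r 0) ρ with hc | hc
      · refine ⟨hc, ?_⟩
        have := A (hc.trans_lt l0)
        by_contra! hlt
        nlinarith
      · have hc1 : r 1 ≤ σ := by
          by_contra! hlt
          exact hnot ⟨hc, hlt⟩
        have := B (hc1.trans_lt l1)
        nlinarith
    have A' := A (hle.1.trans_lt l0)
    have B' := B (hle.2.trans_lt l1)
    have hr0 : r 0 = ρ := by
      refine le_antisymm hle.1 ?_
      by_contra! hlt
      have := mul_le_mul_of_nonneg_left B' hq.le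
      nlinarith
    have hr1 : r 1 = σ := by
      refine le_antisymm hle.2 ?_
      rw [hr0] at B'
      linarith
    refine ⟨⟨hr0, hr1⟩, ?_, ?_⟩
    · -- Bidder 2 wins at `(r 0 + ε, vbar 1)` for small `ε`.
      obtain ⟨ε, hε, hε'⟩ := exists_between (show 0 < min (vbar 0 - ρ) ((vbar 1 - σ) / γ) from
        lt_min (by linarith) (div_pos (by linarith) hγ))
      rw [lt_min_iff, lt_div_iff₀ hγ] at hε'
      have := hright (r 0 + ε) ⟨by linarith, by linarith⟩ _ ⟨h1.le, le_rfl⟩ (by linarith)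
        (by rw [add_sub_cancel_left]; linarith)
      rw [hr0, hr1, add_sub_cancel_left, e1] at this
      exact le_of_mul_le_mul_right (by linarith) hε
    · -- Bidder 1 wins at `(vbar 0, r 1 + ε)` for small `ε`.
      obtain ⟨ε, hε, hε'⟩ := exists_between (show 0 < min (vbar 1 - σ) (γ * (vbar 0 - ρ)) from
        lt_min (by linarith) (mul_pos hγ (by linarith)))
      rw [lt_min_iff] at hε'
      have := hleft _ ⟨h0.le, le_rfl⟩ (r 1 + ε) ⟨by linarith, by linarith⟩ (by linarith)
        (by linarith) (by rw [add_sub_cancel_left, hr0]; exact hε'.2)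
      rw [hr0, hr1, add_sub_cancel_left, e0] at this
      have h2 : q * ε ≤ ε / γ := by linarith
      rw [le_div_iff₀ hγ] at h2
      rw [le_div_iff₀ hq]
      exact le_of_mul_le_mul_right (by linarith) hε
  · rintro ⟨⟨hr0, hr1⟩, hpγ, hγq⟩
    rw [le_div_iff₀ hq] at hγq
    refine h.isMinorant_of hγ ?_ ?_ ?_ <;> intro v hv <;>
      have hv0 : v 0 ≤ vbar 0 := hv.2 0 <;> have hv1 : v 1 ≤ vbar 1 := hv.2 1 <;>
      rw [cornerAffine_pivot_eq hp.le hq.le, hr0, hr1]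
    · intro a b
      nlinarith
    · intro _
      have a1 := mul_le_mul_of_nonneg_left (sub_le_sub_right hv0 ρ) hp.le
      have a2 : q * (v 1 - σ) ≤ max (v 1 - σ) 0 / γ := by
        rw [le_div_iff₀ hγ]
        rcases le_total (v 1 - σ) 0 with hc | hc
        · rw [max_eq_right hc]; nlinarith [mul_pos hq hγ]
        · rw [max_eq_left hc]; nlinarith
      linarith
    · intro _
      have a1 := mul_le_mul_of_nonneg_left (sub_le_sub_right hv1 σ) hq.le
      have a2 : p * (v 0 - ρ) ≤ max (γ * (v 0 - ρ)) 0 := by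
        rcases le_total (v 0 - ρ) 0 with hc | hc
        · exact le_max_of_le_right (by nlinarith)
        · exact le_max_of_le_left (by nlinarith)
      linarith

/-- The minorant with slopes `g` and `1 / g`. Comparing it with the winner's payment along the two
far edges of the box forces the score tie line to be the line with slope `g` through
`(criticalValue vbar g, vbar 1)`; the unsold region then keeps the prices below the pivots. -/
lemma IsLSA.isMinorant_iff_of_hyperbola {M : Mechanism vbar} {γ : ℝ} {r : Profile}
    (h : M.IsLSA γ r) (hγ : 0 < γ) (hr : r ∈ Icc 0 vbar) (h1 : 0 < vbar 1) (h10 : vbar 1 ≤ vbar 0)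
    {g : ℝ} (hg : 0 < g) :
    M.IsMinorant (criticalValue vbar g) g (1 / g) ↔
      γ = g ∧ (vbar 1 - r 1) / (criticalValue vbar g - r 0) = g ∧
        r 0 / vbar 0 + r 1 / vbar 1 ≤ 1 := by
  have h0 : 0 < vbar 0 := h1.trans_le h10
  have ec := mul_sub_criticalValue (vbar := vbar) hg.le
  have cle := criticalValue_le h10 hg.le
  have lec := le_criticalValue h10 hg.le
  have r0 : r 0 ≤ vbar 0 := hr.2 0
  have r1 : r 1 ≤ vbar 1 := hr.2 1
  have r0' : 0 ≤ r 0 := hr.1 0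
  have r1' : 0 ≤ r 1 := hr.1 1
  have hpiv := pivot_inv_eq (vbar := vbar) hg
  have hadd := pivot_add_pivot_inv (vbar := vbar) hg
  have hg' : 0 < 1 / g := by positivity
  set c := criticalValue vbar g
  set ρ := pivot (vbar 0) g
  set σ := pivot (vbar 1) (1 / g)
  have hL : ∀ y z, cornerAffine vbar c g (1 / g) ![y, z]
      = c - g * (vbar 0 - y) - (vbar 1 - z) / g := by
    intro y z
    simp only [cornerAffine, Matrix.cons_val_zero, Matrix.cons_val_one]
    ring
  constructor
  · intro hmin
    have hleft : ∀ z, r 1 ≤ z → z ≤ vbar 1 → r 0 < vbar 0 → z - r 1 < γ * (vbar 0 - r 0) →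
        c - (vbar 1 - z) / g ≤ r 0 + (z - r 1) / γ := by
      intro z hrz hz hlt hst
      have := h.minorant_le_left hγ hmin ⟨h0.le, le_rfl⟩ ⟨r1'.trans hrz, hz⟩ hrz hlt hst
      rw [hL] at this
      linarith
    have hright : ∀ y, r 0 ≤ y → y ≤ vbar 0 → γ * (y - r 0) < vbar 1 - r 1 →
        c - g * (vbar 0 - y) ≤ r 1 + γ * (y - r 0) := by
      intro y hry hy hst
      have := h.minorant_le_right hγ hmin ⟨r0'.trans hry, hy⟩ ⟨h1.le, le_rfl⟩ hry hst
      rw [hL, sub_self, zero_div, sub_zero] at this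
      exact this
    have hnot : ¬ (ρ < r 0 ∧ σ < r 1) := fun hlt => by
      refine h.not_isMinorant_of_pivot_lt hγ hr h0.le h1.le hg hg' hlt.1 hlt.2 ?_
      rw [pivot_add_pivot_inv hg]
      exact hmin
    have hρc : ρ < c := by
      have : 0 < σ := by unfold σ pivot; positivity
      linarith
    have hσ1 : σ < vbar 1 := by
      have := mul_pos hg (sub_pos.mpr hρc)
      linarith
    -- If the tie line through `r` passed below the top corner, bidder 2 would win there and pay
    -- less than `vbar 1 ≤ c`.
    have htop : vbar 1 - r 1 ≤ γ * (vbar 0 - r 0) := by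
      by_contra! hlt
      have := hright _ r0 le_rfl hlt
      rw [sub_self, mul_zero, sub_zero] at this
      linarith
    -- So it meets the top edge at some `y`, which is what bidder 1 pays at the top corner
    -- if she wins there.
    obtain ⟨y, hy⟩ : ∃ y, γ * (y - r 0) = vbar 1 - r 1 :=
      ⟨r 0 + (vbar 1 - r 1) / γ, by rw [add_sub_cancel_left, mul_div_cancel₀ _ hγ.ne']⟩
    have hyr : r 0 ≤ y := by
      by_contra! hlt
      nlinarith
    have hy0 : y ≤ vbar 0 := by
      rw [← hy] at htop
      linarith [le_of_mul_le_mul_left htop hγ]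
    have hcy : c ≤ y := by
      rcases eq_or_lt_of_le hy0 with rfl | hlt
      · exact cle
      · have := hleft _ r1 le_rfl (hyr.trans_lt hlt)
          (by rw [← hy]; exact mul_lt_mul_of_pos_left (by linarith) hγ)
        rw [← hy, sub_self, zero_div, sub_zero, mul_div_cancel_left₀ _ hγ.ne'] at this
        linarith
    have hr1 : r 1 < vbar 1 := by
      refine lt_of_le_of_ne r1 fun heq => ?_
      have : y = r 0 := by
        rw [heq, sub_self] at hy
        rcases mul_eq_zero.mp hy with h' | h'
        · exact absurd h' hγ.ne'
        · linarith
      exact hnot ⟨by linarith, by linarith⟩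
    have hyr' : r 0 < y := by
      by_contra! hle
      nlinarith
    -- As `w` tends to `y`, the payment of bidder 2 at `(w, vbar 1)` tends to `vbar 1`.
    have hedge : ∀ w, r 0 ≤ w → w < y → γ * (y - w) ≤ g * (c - w) := by
      intro w hw hwy
      have := hright w hw (hwy.le.trans hy0)
        (by rw [← hy]; exact mul_lt_mul_of_pos_left (by linarith) hγ)
      linarith
    have hyc : y = c := by
      refine le_antisymm ?_ hcy
      by_contra! hlt
      have := hedge (max (r 0) c) (le_max_left _ _) (max_lt hyr' hlt)
      have h2 := mul_pos hγ (sub_pos.mpr (max_lt hyr' hlt))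
      have h3 := mul_nonneg hg.le (sub_nonneg.mpr (le_max_right (r 0) c))
      linarith
    subst hyc
    have hγg : γ ≤ g := le_of_mul_le_mul_right (hedge _ le_rfl hyr') (by linarith)
    have hgγ : g ≤ γ := by
      have := hleft _ le_rfl r1 (hyr'.trans_le hy0)
        (by rw [sub_self]; exact mul_pos hγ (by linarith))
      rw [sub_self, zero_div, ← hy] at this
      have h2 : c - r 0 ≤ γ * (c - r 0) / g := by linarith
      rw [le_div_iff₀ hg] at h2
      exact le_of_mul_le_mul_right (by linarith) (sub_pos.mpr hyr')
    obtain rfl : γ = g := le_antisymm hγg hgγ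
    refine ⟨rfl, ?_, ?_⟩
    · rw [← hy, mul_div_cancel_right₀ _ (sub_pos.mpr hyr').ne']
    · rw [tie_line_le_one_iff h0 h1 hγ hy.symm]
      by_contra! hlt
      exact hnot ⟨hlt, by nlinarith⟩
  · rintro ⟨rfl, hdiv, hbud⟩
    -- A quotient with denominator zero would be zero, hence different from `γ`.
    have hne : c - r 0 ≠ 0 := by
      intro h'
      rw [h', div_zero] at hdiv
      exact hγ.ne hdiv
    have htie : vbar 1 - r 1 = γ * (c - r 0) := by
      rw [div_eq_iff hne] at hdiv
      exact hdiv
    have hρ : r 0 ≤ ρ := (tie_line_le_one_iff h0 h1 hγ htie).mp hbud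
    have hσ : r 1 ≤ σ := by nlinarith
    refine h.isMinorant_of hγ ?_ ?_ ?_ <;> intro v hv <;>
      have hv0 : v 0 ≤ vbar 0 := hv.2 0 <;> have hv1 : v 1 ≤ vbar 1 := hv.2 1
    · intro a b
      have h2 := cornerAffine_pivot_eq (vbar := vbar) hγ.le hg'.le v
      rw [pivot_add_pivot_inv hγ] at h2
      rw [h2]
      have := mul_nonneg hγ.le (show 0 ≤ ρ - v 0 by linarith)
      have := mul_nonneg hg'.le (show 0 ≤ σ - v 1 by linarith)
      linarith
    · intro _
      have a1 := mul_nonneg hγ.le (sub_nonneg.mpr hv0)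
      have a2 : (v 1 - r 1) / γ ≤ max (v 1 - r 1) 0 / γ := by
        gcongr
        exact le_max_left _ _
      have a3 : r 0 + (v 1 - r 1) / γ = c - 1 / γ * (vbar 1 - v 1) := by
        have : r 1 = vbar 1 - γ * (c - r 0) := by linarith
        rw [this]
        field_simp
        ring
      simp only [cornerAffine]
      linarith
    · intro _
      have a1 := mul_nonneg hg'.le (sub_nonneg.mpr hv1)
      have a2 := le_max_left (γ * (v 0 - r 0)) 0
      simp only [cornerAffine]
      linarith

end Mechanism

/-! ### Optimal parameters -/

/-- If the best admissible affine function minorizes some linear score auction, optimal parameters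
are those whose auctions it minorizes, provided this depends on the parameters only. -/
lemma isOptimalParameters_iff {vbar m : Profile} (h1 : 0 < vbar 1) (h10 : vbar 1 ≤ vbar 0)
    (hm : ∀ i, m i ∈ Ioo 0 (vbar i)) {c p q : ℝ}
    (hbest : ∀ c' p' q', Admissible vbar c' p' q' →
      cornerAffine vbar c p q m ≤ cornerAffine vbar c' p' q' m → c' = c ∧ p' = p ∧ q' = q)
    {Good : ℝ → Profile → Prop}
    (hgood : ∀ (M : Mechanism vbar) γ r, 0 < γ → r ∈ Icc 0 vbar → M.IsLSA γ r →
      (M.IsMinorant c p q ↔ Good γ r))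
    (hex : ∃ γ r, 0 < γ ∧ r ∈ Icc 0 vbar ∧ Good γ r) :
    (∀ γ r, IsOptimalParameters vbar m γ r ↔ 0 < γ ∧ r ∈ Icc 0 vbar ∧ Good γ r) ∧
    (∀ γ r, IsOptimalParameters vbar m γ r →
      ∀ M : Mechanism vbar, M.IsLSA γ r → M.IsOptimal m) := by
  obtain ⟨γ₀, r₀, hγ₀, hr₀, hg₀⟩ := hex
  have hM₀ := (hgood _ _ _ hγ₀ hr₀ (Mechanism.scoreAuction_isLSA hγ₀ hr₀)).mpr hg₀
  have hopt := Mechanism.isOptimal_iff_isMinorant h1 h10 hm hbest hM₀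
  have key : ∀ γ r, IsOptimalParameters vbar m γ r ↔ 0 < γ ∧ r ∈ Icc 0 vbar ∧ Good γ r := by
    refine fun γ r => ⟨?_, ?_⟩
    · rintro ⟨hγ, hr, M, hM, hMo⟩
      exact ⟨hγ, hr, (hgood M γ r hγ hr hM).mp ((hopt M).mp hMo)⟩
    · rintro ⟨hγ, hr, hg⟩
      have hL := Mechanism.scoreAuction_isLSA hγ hr
      exact ⟨hγ, hr, _, hL, (hopt _).mpr ((hgood _ γ r hγ hr hL).mpr hg)⟩
  refine ⟨key, fun γ r h M hM => ?_⟩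
  obtain ⟨hγ, hr, hg⟩ := (key γ r).mp h
  exact (hopt M).mpr ((hgood M γ r hγ hr hM).mpr hg)

/-- The normalized distance `√(1 - m / V)` of the mean from the top value. -/
lemma sqrt_one_sub_div_mem {V m : ℝ} (hm : m ∈ Ioo 0 V) :
    √(1 - m / V) ∈ Ioo 0 1 ∧ V - m = V * √(1 - m / V) ^ 2 ∧
      √(V * (V - m)) = V * √(1 - m / V) := by
  have hV : 0 < V := hm.1.trans hm.2
  have hlt : m / V < 1 := (div_lt_one hV).mpr hm.2
  have hpos : 0 < m / V := div_pos hm.1 hV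
  refine ⟨⟨Real.sqrt_pos.mpr (by linarith), ?_⟩, ?_, ?_⟩
  · rw [Real.sqrt_lt' one_pos]; linarith
  · rw [Real.sq_sqrt (by linarith)]; field_simp
  · have e : V * (V - m) = V ^ 2 * (1 - m / V) := by field_simp
    rw [e, Real.sqrt_mul (by positivity), Real.sqrt_sq hV.le]

lemma pivot_peak {V k : ℝ} (hk : 0 < k) : pivot V ((1 - k) / k) = V * (1 - k) := by
  rw [pivot]
  have : 1 + (1 - k) / k = 1 / k := by field_simp; ring
  rw [this]
  field_simp

/-- The slopes of the best minorant are the peaks `(1 - k) / k`, whose pivots are the prices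
`lowMeansPrice`; low means say that their product is less than one. -/
lemma isOptimalParameters_iff_of_low {vbar m : Profile} (h1 : 0 < vbar 1)
    (h10 : vbar 1 ≤ vbar 0) (hm : ∀ i, m i ∈ Ioo 0 (vbar i))
    (hlow : 1 < √(1 - m 0 / vbar 0) + √(1 - m 1 / vbar 1)) :
    ((∀ γ r, IsOptimalParameters vbar m γ r ↔
        r = lowMeansPrice vbar m ∧
        γ ∈ Icc (lowMeansPrice vbar m 0 / (vbar 0 - lowMeansPrice vbar m 0))
          ((vbar 1 - lowMeansPrice vbar m 1) / lowMeansPrice vbar m 1)) ∧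
      {γ | IsOptimalParameters vbar m γ (lowMeansPrice vbar m)}.Nontrivial) ∧
    (∀ γ r, IsOptimalParameters vbar m γ r →
      ∀ M : Mechanism vbar, M.IsLSA γ r → M.IsOptimal m) := by
  have h0 : 0 < vbar 0 := h1.trans_le h10
  obtain ⟨hk₀, em₀, es₀⟩ := sqrt_one_sub_div_mem (hm 0)
  obtain ⟨hk₁, em₁, es₁⟩ := sqrt_one_sub_div_mem (hm 1)
  have eq₀ : lowMeansPrice vbar m 0 = vbar 0 - vbar 0 * √(1 - m 0 / vbar 0) := by
    rw [lowMeansPrice, es₀]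
  have eq₁ : lowMeansPrice vbar m 1 = vbar 1 - vbar 1 * √(1 - m 1 / vbar 1) := by
    rw [lowMeansPrice, es₁]
  set k₀ := √(1 - m 0 / vbar 0)
  set k₁ := √(1 - m 1 / vbar 1)
  obtain ⟨hk₀0, hk₀1⟩ := hk₀
  obtain ⟨hk₁0, hk₁1⟩ := hk₁
  set p := (1 - k₀) / k₀ with hp
  set q := (1 - k₁) / k₁ with hq
  have hp0 : 0 < p := div_pos (by linarith) hk₀0
  have hq0 : 0 < q := div_pos (by linarith) hk₁0
  have hpq : p * q < 1 := by
    rw [hp, hq, div_mul_div_comm, div_lt_one (by positivity)]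
    linarith
  have ρ₀ : lowMeansPrice vbar m 0 = pivot (vbar 0) p := by
    rw [eq₀, hp, pivot_peak hk₀0]; ring
  have ρ₁ : lowMeansPrice vbar m 1 = pivot (vbar 1) q := by
    rw [eq₁, hq, pivot_peak hk₁0]; ring
  have ep : lowMeansPrice vbar m 0 / (vbar 0 - lowMeansPrice vbar m 0) = p := by
    rw [eq₀, hp, sub_sub_cancel]; field_simp
  have eq : (vbar 1 - lowMeansPrice vbar m 1) / lowMeansPrice vbar m 1 = 1 / q := by
    have : (1 - k₁) ≠ 0 := by linarith
    have e : lowMeansPrice vbar m 1 = vbar 1 * (1 - k₁) := by rw [eq₁]; ring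
    rw [eq₁, hq, sub_sub_cancel, ← eq₁, e]; field_simp
  have hrmem : lowMeansPrice vbar m ∈ Icc 0 vbar := by
    have a := pivot_mem h0.le hp0.le
    have b := pivot_mem h1.le hq0.le
    rw [← ρ₀] at a
    rw [← ρ₁] at b
    exact ⟨Fin.forall_fin_two.mpr ⟨a.1, b.1⟩, Fin.forall_fin_two.mpr ⟨a.2, b.2⟩⟩
  have hlt : p < 1 / q := by rwa [lt_div_iff₀ hq0]
  have main := isOptimalParameters_iff h1 h10 hm
    (admissible_best_of_low h0 h1 em₀ em₁ ⟨hk₀0, hk₀1⟩ ⟨hk₁0, hk₁1⟩ hp hq)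
    (Good := fun γ r => (r 0 = pivot (vbar 0) p ∧ r 1 = pivot (vbar 1) q) ∧ p ≤ γ ∧ γ ≤ 1 / q)
    (fun M γ r hγ hr h => h.isMinorant_iff_of_mul_lt_one hγ hr h0 h1 hp0 hq0 hpq)
    ⟨p, _, hp0, hrmem, ⟨ρ₀, ρ₁⟩, le_rfl, hlt.le⟩
  rw [ep, eq]
  have hiff : ∀ γ r, IsOptimalParameters vbar m γ r ↔
      r = lowMeansPrice vbar m ∧ γ ∈ Icc p (1 / q) := by
    intro γ r
    rw [main.1]
    constructor
    · rintro ⟨-, -, ⟨a, b⟩, hγ⟩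
      exact ⟨funext (Fin.forall_fin_two.mpr ⟨a.trans ρ₀.symm, b.trans ρ₁.symm⟩), hγ⟩
    · rintro ⟨rfl, hγ⟩
      exact ⟨hp0.trans_le hγ.1, hrmem, ⟨ρ₀, ρ₁⟩, hγ⟩
  refine ⟨⟨hiff, p, ?_, 1 / q, ?_, hlt.ne⟩, main.2⟩
  · exact (hiff _ _).mpr ⟨rfl, le_rfl, hlt.le⟩
  · exact (hiff _ _).mpr ⟨rfl, hlt.le, le_rfl⟩

lemma isOptimalParameters_iff_of_high {vbar m : Profile} (h1 : 0 < vbar 1)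
    (h10 : vbar 1 ≤ vbar 0) (hm : ∀ i, m i ∈ Ioo 0 (vbar i))
    (hhigh : √(1 - m 0 / vbar 0) + √(1 - m 1 / vbar 1) ≤ 1) {g : ℝ} (hg : 0 < g)
    (hgs : SlopeEquation vbar m g) :
    ((∀ γ r, IsOptimalParameters vbar m γ r ↔
        γ = g ∧ r ∈ Icc 0 vbar ∧ (vbar 1 - r 1) / (criticalValue vbar g - r 0) = g ∧
          r 0 / vbar 0 + r 1 / vbar 1 ≤ 1) ∧
      {r | IsOptimalParameters vbar m g r}.Nontrivial) ∧
    (∀ γ r, IsOptimalParameters vbar m γ r →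
      ∀ M : Mechanism vbar, M.IsLSA γ r → M.IsOptimal m) := by
  have h0 : 0 < vbar 0 := h1.trans_le h10
  obtain ⟨hk₀, em₀, -⟩ := sqrt_one_sub_div_mem (hm 0)
  obtain ⟨hk₁, em₁, -⟩ := sqrt_one_sub_div_mem (hm 1)
  have hg' : 0 < 1 / g := by positivity
  have p0 := pivot_mem h0.le hg.le
  have p1 := pivot_mem h1.le hg'.le
  have hρ : 0 < pivot (vbar 0) g := by unfold pivot; positivity
  have hσ : 0 < pivot (vbar 1) (1 / g) := by unfold pivot; positivity
  have hpiv := pivot_inv_eq (vbar := vbar) hg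
  have hadd := pivot_add_pivot_inv (vbar := vbar) hg
  set ρ := pivot (vbar 0) g
  set σ := pivot (vbar 1) (1 / g)
  -- Prices on the tie line, at distance `e` below the pivots.
  have hgood : ∀ e, 0 ≤ e → e ≤ min ρ (σ / g) → ![ρ - e, σ - g * e] ∈ Icc 0 vbar ∧
      (vbar 1 - ![ρ - e, σ - g * e] 1) / (criticalValue vbar g - ![ρ - e, σ - g * e] 0) = g ∧
      ![ρ - e, σ - g * e] 0 / vbar 0 + ![ρ - e, σ - g * e] 1 / vbar 1 ≤ 1 := by
    intro e he hle
    rw [le_min_iff, le_div_iff₀ hg] at hle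
    have hge := mul_nonneg hg.le he
    have htie : vbar 1 - (σ - g * e) = g * (criticalValue vbar g - (ρ - e)) := by linarith
    refine ⟨vec_mem_Icc ⟨by linarith, by linarith [p0.2]⟩ ⟨by linarith, by linarith [p1.2]⟩, ?_,
      (tie_line_le_one_iff h0 h1 hg (by simpa using htie)).mpr (by change ρ - e ≤ ρ; linarith)⟩
    simp only [Matrix.cons_val_zero, Matrix.cons_val_one]
    rw [htie, mul_div_cancel_right₀ _ (by linarith)]
  have hmin : 0 < min ρ (σ / g) := lt_min hρ (by positivity)
  have main := isOptimalParameters_iff h1 h10 hm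
    (admissible_best_of_high h1 h10 (hm 1).2 em₀ em₁ hk₀ hk₁ hhigh hg hgs)
    (fun M γ r hγ hr h => h.isMinorant_iff_of_hyperbola hγ hr h1 h10 hg)
    ⟨g, _, hg, (hgood 0 le_rfl hmin.le).1, rfl, (hgood 0 le_rfl hmin.le).2⟩
  have hiff : ∀ γ r, IsOptimalParameters vbar m γ r ↔
      γ = g ∧ r ∈ Icc 0 vbar ∧ (vbar 1 - r 1) / (criticalValue vbar g - r 0) = g ∧
          r 0 / vbar 0 + r 1 / vbar 1 ≤ 1 := by
    intro γ r
    rw [main.1]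
    constructor
    · rintro ⟨-, hr, rfl, h⟩
      exact ⟨rfl, hr, h⟩
    · rintro ⟨rfl, hr, h⟩
      exact ⟨hg, hr, rfl, h⟩
  refine ⟨⟨hiff, _, (hiff _ _).mpr ⟨rfl, hgood 0 le_rfl hmin.le⟩, _,
    (hiff _ _).mpr ⟨rfl, hgood _ hmin.le le_rfl⟩, fun h => ?_⟩, main.2⟩
  have := congrFun h 0
  simp only [Matrix.cons_val_zero] at this
  linarith

/-- On the score tie line with slope `g` through `(criticalValue vbar g, vbar 1)`, bidder 1 beats
even the highest value of bidder 2 above the critical value, and only there. -/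
lemma Mechanism.IsLSA.critical {vbar : Profile} {M : Mechanism vbar} {g : ℝ} {r : Profile}
    (h : M.IsLSA g r) (hg : 0 < g) (hr : r ∈ Icc 0 vbar) (h1 : 0 < vbar 1)
    (hdiv : (vbar 1 - r 1) / (criticalValue vbar g - r 0) = g) :
    (∀ v ∈ Icc 0 vbar, criticalValue vbar g < v 0 → M.x 0 v = 1) ∧
    (∀ v1 ∈ Icc 0 (vbar 0), v1 < criticalValue vbar g →
      ∃ v2 ∈ Icc 0 (vbar 1), M.x 0 ![v1, v2] = 0) := by
  -- A quotient with denominator zero would be zero, hence different from `g`.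
  have hne : criticalValue vbar g - r 0 ≠ 0 := by
    intro h'
    rw [h', div_zero] at hdiv
    exact hg.ne hdiv
  rw [div_eq_iff hne] at hdiv
  have r1 : r 1 ≤ vbar 1 := hr.2 1
  constructor
  · intro v hv hlt
    have hv1 : v 1 ≤ vbar 1 := hv.2 1
    have := mul_lt_mul_of_pos_left (sub_lt_sub_right hlt (r 0)) hg
    exact h.x_zero_eq_one hv (max_lt (by linarith) (by linarith))
  · intro y hy hlt
    have := mul_lt_mul_of_pos_left (sub_lt_sub_right hlt (r 0)) hg
    refine ⟨vbar 1, ⟨h1.le, le_rfl⟩, h.x_zero_eq_zero (vec_mem_Icc hy ⟨h1.le, le_rfl⟩) ?_⟩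
    simp only [Matrix.cons_val_zero, Matrix.cons_val_one]
    exact lt_max_of_lt_left (by linarith)

end

theorem mainTheorem8 (vbar m : Profile) (hv1 : 0 < vbar 1) (hv : vbar 1 ≤ vbar 0)
    (hm : ∀ i, m i ∈ Set.Ioo 0 (vbar i)) :
    -- optimality of the parameters does not depend on how ties are broken
    (∀ γ r, IsOptimalParameters vbar m γ r →
      ∀ M : Mechanism vbar, M.IsLSA γ r → M.IsOptimal m) ∧
    -- low means
    (1 < √(1 - m 0 / vbar 0) + √(1 - m 1 / vbar 1) →
      (∀ γ r, IsOptimalParameters vbar m γ r ↔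
        r = lowMeansPrice vbar m ∧
        γ ∈ Set.Icc (lowMeansPrice vbar m 0 / (vbar 0 - lowMeansPrice vbar m 0))
          ((vbar 1 - lowMeansPrice vbar m 1) / lowMeansPrice vbar m 1)) ∧
      {γ | IsOptimalParameters vbar m γ (lowMeansPrice vbar m)}.Nontrivial) ∧
    -- high means
    (√(1 - m 0 / vbar 0) + √(1 - m 1 / vbar 1) ≤ 1 →
      ∃ γs : ℝ, 0 < γs ∧ SlopeEquation vbar m γs ∧
        (∀ γ, 0 < γ → SlopeEquation vbar m γ → γ = γs) ∧
        (∀ γ r, IsOptimalParameters vbar m γ r ↔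
          γ = γs ∧ r ∈ Set.Icc 0 vbar ∧
          (vbar 1 - r 1) / (criticalValue vbar γs - r 0) = γs ∧
          r 0 / vbar 0 + r 1 / vbar 1 ≤ 1) ∧
        {r | IsOptimalParameters vbar m γs r}.Nontrivial ∧
        -- the critical value of bidder 1: above it she always wins, below it she may lose
        criticalValue vbar γs ≤ vbar 0 ∧
        (∀ r, IsOptimalParameters vbar m γs r → ∀ M : Mechanism vbar, M.IsLSA γs r →
          (∀ v ∈ Set.Icc 0 vbar, criticalValue vbar γs < v 0 → M.x 0 v = 1) ∧
          (∀ v1 ∈ Set.Icc 0 (vbar 0), v1 < criticalValue vbar γs →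
            ∃ v2 ∈ Set.Icc 0 (vbar 1), M.x 0 ![v1, v2] = 0))) := by
  refine ⟨?_, fun hlow => (isOptimalParameters_iff_of_low hv1 hv hm hlow).1, fun hhigh => ?_⟩
  · rcases lt_or_ge 1 (√(1 - m 0 / vbar 0) + √(1 - m 1 / vbar 1)) with hlow | hhigh
    · exact (isOptimalParameters_iff_of_low hv1 hv hm hlow).2
    · obtain ⟨g, hg, hgs⟩ := exists_slopeEquation hv (hm 0).2 (hm 1).2
      exact (isOptimalParameters_iff_of_high hv1 hv hm hhigh hg hgs).2
  · obtain ⟨g, hg, hgs⟩ := exists_slopeEquation hv (hm 0).2 (hm 1).2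
    obtain ⟨⟨hiff, hnt⟩, -⟩ := isOptimalParameters_iff_of_high hv1 hv hm hhigh hg hgs
    refine ⟨g, hg, hgs, fun γ hγ h => slopeEquation_unique hv (hm 1).2 hγ hg h hgs, hiff, hnt,
      criticalValue_le hv hg.le, fun r hr M hM => ?_⟩
    obtain ⟨-, hrm, hdiv, -⟩ := (hiff _ _).mp hr
    exact hM.critical hg hrm hv1 hdiv
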